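/- Let $r\ge 1$, let $d_1,\dots,d_r\ge 1$ be integers with $d_1>1$, put $n=\sum_i d_i$, and let $\epsilon>0$. Consider, for $(W,X,Y)\in\mathbb R\times\mathbb R^r\times\mathbb R^r$, the autonomous system $$X_i'=X_i\Big(\sum_{j=1}^r X_j^2-1\Big)+\frac{Y_i^2}{\sqrt{d_i}}+\frac{\epsilon}{2}\big(\sqrt{d_i}-X_i\big)W^2,$$ $$Y_i'=Y_i\Big(\sum_{j=1}^r X_j^2-\frac{X_i}{\sqrt{d_i}}-\frac{\epsilon}{2}W^2\Big),\qquad W'=W\Big(\sum_{j=1}^r X_j^2-\frac{\epsilon}{2}W^2\Big),$$ $i=1,\dots,r$, where $'=d/ds$, and set $$\mathcal L=\sum_{i=1}^r(X_i^2+Y_i^2)-1,\qquad \mathcal H=\sum_{i=1}^r\sqrt{d_i}\,X_i,\qquad \mathcal Q=\mathcal L+\frac{\epsilon}{2}(n-1)W^2 .$$ Let $c$ be the critical point $W=0$, $X_1=\beta$, $Y_1=\hat\beta$, $X_i=Y_i=0$ for $i>1$, where $\beta=1/\sqrt{d_1}$ and $\hat\beta=\sqrt{1-\beta^2}$. Its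 unstable manifold is the set of all points whose backward orbit exists for all negative times and converges to $c$. An emanating trajectory on $(-\infty,b)$, $b\in\mathbb R\cup\{+\infty\}$, is a solution $\gamma$ of the system on $(-\infty,b)$ with $\gamma(s)\to c$ as $s\to-\infty$ and with $W>0$ and all $Y_i>0$. (a) There is an $r$-parameter family of emanating trajectories, defined for all $s\in\mathbb R$ and lying in the unstable manifold of $c$, along which $\mathcal H<1$ and $\mathcal Q<0$, and also $\mathcal L<0$ and $W<\sqrt{2/\epsilon}$, for all $s\in\mathbb R$; each of these trajectories is bounded. Here an $r$-parameter family means a family $(\Phi_p)_{p\in U}$ indexed by a nonempty open set $U\subset\mathbb R^r$ such that $(p,s)\mapsto\Phi_p(s)$ is $C^\infty$ and is an injective immersion on $U\times\mathbb R$ (in particular, different parameters give different orbits). (b) If $\gamma$ is any emanating trajectory on $(-\infty,b)$, $b\in\mathbb R$, with $\mathcal H<1$ and $\mathcal Q<0$ on $(-\infty,b)$, then $\mathcal L<0$ and $W<\sqrt{2/\epsilon}$ on $(-\infty,b)$, and $\gamma$ extends to a bounded emanating trajectory defined for all $s\in\mathbb R$, along which $\mathcal H<1$, $\mathcal Q<0$,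 $\mathcal L<0$ and $W<\sqrt{2/\epsilon}$ for all $s\in\mathbb R$. -/

import Mathlib

open Filter Topology Set
open scoped ContDiff

namespace ExpandingSoliton

/-- Phase space: points `z = (W, X, Y)` with `W ∈ ℝ` and `X, Y ∈ ℝ^r`. The factor
distinguished in the text as the first one has index `0 : Fin r`. -/
abbrev Phase (r : ℕ) : Type := ℝ × (Fin r → ℝ) × (Fin r → ℝ)

/-- The coordinate `W`. -/
def cW {r : ℕ} (z : Phase r) : ℝ := z.1

/-- The coordinates `X_i`. -/
def cX {r : ℕ} (z : Phase r) : Fin r → ℝ := z.2.1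

/-- The coordinates `Y_i`. -/
def cY {r : ℕ} (z : Phase r) : Fin r → ℝ := z.2.2

/-- The right-hand side of the expanding soliton system in the variables `(W, X, Y)`. -/
noncomputable def field {r : ℕ} (d : Fin r → ℕ) (ε : ℝ) (z : Phase r) : Phase r :=
  (cW z * ((∑ j, cX z j ^ 2) - ε / 2 * cW z ^ 2),
   fun i => cX z i * ((∑ j, cX z j ^ 2) - 1) + cY z i ^ 2 / √(d i)
      + ε / 2 * (√(d i) - cX z i) * cW z ^ 2,
   fun i => cY z i * ((∑ j, cX z j ^ 2) - cX z i / √(d i) - ε / 2 * cW z ^ 2))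

/-- `β = 1 / √d₁`. -/
noncomputable def beta {r : ℕ} [NeZero r] (d : Fin r → ℕ) : ℝ := 1 / √(d 0)

/-- `β̂ = √(1 - β²)`. -/
noncomputable def betaHat {r : ℕ} [NeZero r] (d : Fin r → ℕ) : ℝ := √(1 - beta d ^ 2)

/-- The critical point `W = 0`, `X₁ = β`, `Y₁ = β̂`, `X_i = Y_i = 0` for `i > 1`. -/
noncomputable def critPoint {r : ℕ} [NeZero r] (d : Fin r → ℕ) : Phase r :=
  (0, Pi.single 0 (beta d), Pi.single 0 (betaHat d))

/-- `L = ∑ (X_i² + Y_i²) - 1`. -/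
def calL {r : ℕ} (z : Phase r) : ℝ := (∑ i, (cX z i ^ 2 + cY z i ^ 2)) - 1

/-- `H = ∑ √d_i X_i`. -/
noncomputable def calH {r : ℕ} (d : Fin r → ℕ) (z : Phase r) : ℝ := ∑ i, √(d i) * cX z i

/-- `Q = L + (ε/2) (n - 1) W²`, where `n = ∑ d_i`. -/
noncomputable def calQ {r : ℕ} (d : Fin r → ℕ) (ε : ℝ) (z : Phase r) : ℝ :=
  calL z + ε / 2 * ((∑ i, (d i : ℝ)) - 1) * cW z ^ 2

/-- The unstable manifold of the critical point: all points whose backward orbit exists for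
all negative times and converges to the critical point. -/
def unstableManifold {r : ℕ} [NeZero r] (d : Fin r → ℕ) (ε : ℝ) : Set (Phase r) :=
  {z | ∃ γ : ℝ → Phase r, γ 0 = z ∧
    (∀ s ∈ Iic (0 : ℝ), HasDerivWithinAt γ (field d ε (γ s)) (Iic 0) s) ∧
    Tendsto γ atBot (𝓝 (critPoint d))}

/-- `γ`, restricted to the set `I` (the whole line or a half-line `(-∞, b)`), is a trajectory of
the system emanating from the critical point at `s = -∞`, with `W` and all `Y_i` positive. -/
structure IsEmanatingTrajectory {r : ℕ} [NeZero r] (d : Fin r → ℕ) (ε : ℝ)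
    (I : Set ℝ) (γ : ℝ → Phase r) : Prop where
  solves : ∀ s ∈ I, HasDerivAt γ (field d ε (γ s)) s
  tendsto_critPoint : Tendsto γ atBot (𝓝 (critPoint d))
  W_pos : ∀ s ∈ I, 0 < cW (γ s)
  Y_pos : ∀ s ∈ I, ∀ i, 0 < cY (γ s) i

/-- An `r`-parameter family of trajectories of the system, with parameters in `U`: a nonempty
open set `U ⊆ ℝ^r` of parameters, smooth dependence on parameter and time, and `r` effective
parameters: the map `(p, s) ↦ Φ p s` is an injective immersion on `U × ℝ`. In particular, distinct
parameters give disjoint orbits, not just different time parametrisations of the same orbit. -/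
structure IsParameterFamily {r : ℕ} (U : Set (Fin r → ℝ)) (Φ : (Fin r → ℝ) → ℝ → Phase r) :
    Prop where
  isOpen : IsOpen U
  nonempty : U.Nonempty
  smooth : ContDiffOn ℝ ∞ (fun q : (Fin r → ℝ) × ℝ => Φ q.1 q.2) (U ×ˢ univ)
  injOn : InjOn (fun q : (Fin r → ℝ) × ℝ => Φ q.1 q.2) (U ×ˢ univ)
  immersion : ∀ p ∈ U, ∀ s : ℝ,
    Function.Injective (fderiv ℝ (fun q : (Fin r → ℝ) × ℝ => Φ q.1 q.2) (p, s))

end ExpandingSoliton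

namespace ExpandingSoliton

/-! ### Comparison arguments, uniqueness and continuation for autonomous equations. -/

section

/-! Two facts carry the theorem. The first is an invariant region. Along solutions, `Q' = (...) Q +
ε W² (H - 1)` and `(H - 1)' = (...) (H - 1) + Q`, a linear pair with nonnegative coupling, so `Q <
0`, `H < 1` persists forward in time (`neg_of_hasDerivAt_coupled`, `InRegion.forward_invariant`).
There `L ≥ -1` and `n ≥ 2` bound the solution (`InRegion.bounds`), so it is global
(`exists_extension`). This already gives (b).

The second is a parametrisation of trajectories leaving `c`. The linearisation at `c` has eigenvalue
`1/d₁` on `W` and the `Y_i` with `i > 1`, and `2/d₁` in one more direction, detected by `Q`. With `t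
= exp (s / d₁)`, put `W = t u₁`, `Y_i = t u_i`, `Q = t² q`, `X = X(c) + t² x`, and let `Q` determine
`Y₁`. The system becomes an integral equation on `C([0, 1])` whose nonlinear part has zero
derivative at `0`. The inverse function theorem solves it analytically in the data `(q(0), u(0))`
(`exists_local_solutions`). Moreover `H - 1 = t² k` with `k(0) = d₁ / (d₁ + 1) * q(0)`, so `q(0) <
0` and `u(0) > 0` put the trajectory in the region for very negative `s` (`slopeCI_at_zero`,
`inRegion_orbit`).

A time shift acts on the `r + 1` data by `(q, u) ↦ (κ² q, κ u)`; fixing `q(0) = q₀ < 0` leaves `r`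
effective parameters. Smoothness spreads along orbits by the short-time flow (`exists_smooth_flow`,
`contDiffAt_family`), and the behaviour as `s → -∞` recovers the data, which gives injectivity and
immersion. -/

theorem neg_of_hasDerivAt_linear {f a g : ℝ → ℝ} {s₀ s₁ : ℝ} (h01 : s₀ ≤ s₁)
    (ha : ContinuousOn a (Icc s₀ s₁))
    (hf : ∀ s ∈ Icc s₀ s₁, HasDerivAt f (a s * f s + g s) s)
    (hg : ∀ s ∈ Ioo s₀ s₁, g s ≤ 0) (h0 : f s₀ < 0) : f s₁ < 0 := by
  -- Constant extension beyond the interval makes the primitive of the coefficient differentiable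
  -- everywhere; it serves as the exponent of an integrating factor.
  set b : ℝ → ℝ := IccExtend h01 ((Icc s₀ s₁).domRestrict a) with hb
  have hbc : Continuous b := (continuousOn_iff_continuous_domRestrict.1 ha).Icc_extend'
  have hba : ∀ s ∈ Icc s₀ s₁, b s = a s := fun s hs => by
    rw [hb, IccExtend_of_mem _ _ hs]; rfl
  set B : ℝ → ℝ := fun s => ∫ τ in s₀..s, b τ
  have hB : ∀ s, HasDerivAt B (b s) s := fun s => hbc.integral_hasStrictDerivAt s₀ s |>.hasDerivAt
  have hF : ∀ s ∈ Icc s₀ s₁, HasDerivAt (fun s => f s * Real.exp (-B s))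
      (g s * Real.exp (-B s)) s := fun s hs => by
    refine ((hf s hs).mul (hB s).neg.exp).congr_deriv ?_
    simp only [hba s hs, Pi.neg_apply]; ring
  have hanti : AntitoneOn (fun s => f s * Real.exp (-B s)) (Icc s₀ s₁) := by
    apply antitoneOn_of_deriv_nonpos (convex_Icc _ _)
    · exact fun s hs => (hF s hs).continuousAt.continuousWithinAt
    · rw [interior_Icc]
      exact fun s hs => (hF s (Ioo_subset_Icc_self hs)).differentiableAt.differentiableWithinAt
    · rw [interior_Icc]
      intro s hs
      rw [(hF s (Ioo_subset_Icc_self hs)).deriv]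
      exact mul_nonpos_of_nonpos_of_nonneg (hg s hs) (Real.exp_pos _).le
  have h1 := hanti (left_mem_Icc.2 h01) (right_mem_Icc.2 h01) h01
  have h2 : f s₀ * Real.exp (-B s₀) < 0 := mul_neg_of_neg_of_pos h0 (Real.exp_pos _)
  have h3 : f s₁ * Real.exp (-B s₁) < 0 := lt_of_le_of_lt h1 h2
  by_contra hcon
  exact absurd h3 (not_lt.2 (mul_nonneg (not_lt.1 hcon) (Real.exp_pos _).le))

theorem pos_of_hasDerivAt_linear {f a : ℝ → ℝ} {s₀ s₁ : ℝ} (h01 : s₀ ≤ s₁)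
    (ha : ContinuousOn a (Icc s₀ s₁))
    (hf : ∀ s ∈ Icc s₀ s₁, HasDerivAt f (a s * f s) s) (h0 : 0 < f s₀) : 0 < f s₁ := by
  have := neg_of_hasDerivAt_linear (f := fun s => -f s) (g := fun _ => 0) h01 ha
    (fun s hs => (hf s hs).neg.congr_deriv (by ring)) (fun _ _ => le_rfl) (by simpa using h0)
  simpa using this

/-- A cooperative pair of linear inequalities preserves the negative quadrant. -/
theorem neg_of_hasDerivAt_coupled {f g a b c : ℝ → ℝ} {s₀ s₁ : ℝ} (h01 : s₀ ≤ s₁)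
    (ha : ContinuousOn a (Icc s₀ s₁)) (hb : ContinuousOn b (Icc s₀ s₁))
    (hc : ∀ s ∈ Icc s₀ s₁, 0 ≤ c s)
    (hf : ∀ s ∈ Icc s₀ s₁, HasDerivAt f (a s * f s + c s * g s) s)
    (hg : ∀ s ∈ Icc s₀ s₁, HasDerivAt g (b s * g s + f s) s)
    (hf0 : f s₀ < 0) (hg0 : g s₀ < 0) : f s₁ < 0 ∧ g s₁ < 0 := by
  set m : ℝ → ℝ := fun s => max (f s) (g s)
  have hm : ContinuousOn m (Icc s₀ s₁) := ContinuousOn.sup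
    (fun s hs => (hf s hs).continuousAt.continuousWithinAt)
    (fun s hs => (hg s hs).continuousAt.continuousWithinAt)
  by_contra hcon
  have hm1 : 0 ≤ m s₁ := by
    by_contra h
    exact hcon (max_lt_iff.1 (not_le.1 h))
  -- Before the first time at which `max f g ≥ 0`, each function is a nonpositive source for the
  -- other, so the scalar lemma makes both negative at that time too.
  set Z : Set ℝ := Icc s₀ s₁ ∩ m ⁻¹' Ici 0
  have hZc : IsClosed Z := hm.preimage_isClosed_of_isClosed isClosed_Icc isClosed_Ici
  have hZn : Z.Nonempty := ⟨s₁, right_mem_Icc.2 h01, hm1⟩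
  have hZb : BddBelow Z := ⟨s₀, fun s hs => hs.1.1⟩
  obtain ⟨ht, htm⟩ := hZc.csInf_mem hZn hZb
  set t := sInf Z
  have hlt : ∀ s ∈ Ioo s₀ t, f s < 0 ∧ g s < 0 := fun s hs => by
    by_contra h
    have : s ∈ Z := ⟨⟨hs.1.le, hs.2.le.trans ht.2⟩, by
      by_contra h'
      exact h (max_lt_iff.1 (not_le.1 h'))⟩
    exact absurd (csInf_le hZb this) (not_le.2 hs.2)
  have hsub : Icc s₀ t ⊆ Icc s₀ s₁ := Icc_subset_Icc_right ht.2
  have h1 : f t < 0 := neg_of_hasDerivAt_linear ht.1 (ha.mono hsub) (fun s hs => hf s (hsub hs))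
    (fun s hs => mul_nonpos_of_nonneg_of_nonpos (hc s (hsub (Ioo_subset_Icc_self hs)))
      (hlt s hs).2.le) hf0
  have h2 : g t < 0 := neg_of_hasDerivAt_linear ht.1 (hb.mono hsub) (fun s hs => hg s (hsub hs))
    (fun s hs => (hlt s hs).1.le) hg0
  exact absurd (max_lt h1 h2) (not_lt.2 htm)

section ODE

variable {E : Type*} [NormedAddCommGroup E] [NormedSpace ℝ E] [ProperSpace E]

/-- A `C¹` field need not be globally Lipschitz, but both curves stay in one compact ball, where it
is. -/
theorem ode_unique_right {F : E → E} (hF : ContDiff ℝ 1 F) {f g : ℝ → E} {a b : ℝ}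
    (hf : ContinuousOn f (Icc a b))
    (hf' : ∀ t ∈ Ico a b, HasDerivWithinAt f (F (f t)) (Ici t) t)
    (hg : ContinuousOn g (Icc a b))
    (hg' : ∀ t ∈ Ico a b, HasDerivWithinAt g (F (g t)) (Ici t) t)
    (h : f a = g a) : EqOn f g (Icc a b) := by
  obtain ⟨R, hR⟩ := ((isCompact_Icc.image_of_continuousOn hf).union
    (isCompact_Icc.image_of_continuousOn hg)).isBounded.subset_closedBall 0
  obtain ⟨K, hK⟩ := (hF.contDiffOn (s := Metric.closedBall (0 : E) R)).exists_lipschitzOnWith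
    one_ne_zero (convex_closedBall _ _) (isCompact_closedBall _ _)
  exact ODE_solution_unique_of_mem_Icc_right (v := fun _ => F) (fun _ _ => hK) hf hf'
    (fun t ht => hR (Or.inl ⟨t, Ico_subset_Icc_self ht, rfl⟩)) hg hg'
    (fun t ht => hR (Or.inr ⟨t, Ico_subset_Icc_self ht, rfl⟩)) h

theorem ode_unique {F : E → E} (hF : ContDiff ℝ 1 F) {f g : ℝ → E} {S : Set ℝ}
    (hS : S.OrdConnected) (hf : ∀ t ∈ S, HasDerivAt f (F (f t)) t)
    (hg : ∀ t ∈ S, HasDerivAt g (F (g t)) t) {s : ℝ} (hs : s ∈ S) (h : f s = g s) :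
    EqOn f g S := by
  intro t ht
  rcases le_total s t with hst | hst
  · have hsub : Icc s t ⊆ S := hS.out hs ht
    exact ode_unique_right hF (fun x hx => (hf x (hsub hx)).continuousAt.continuousWithinAt)
      (fun x hx => (hf x (hsub (Ico_subset_Icc_self hx))).hasDerivWithinAt)
      (fun x hx => (hg x (hsub hx)).continuousAt.continuousWithinAt)
      (fun x hx => (hg x (hsub (Ico_subset_Icc_self hx))).hasDerivWithinAt) h
      (right_mem_Icc.2 hst)
  · have hsub : Icc t s ⊆ S := hS.out ht hs
    -- Uniqueness to the left is uniqueness to the right for `-F` under time reversal.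
    have hmem : ∀ x ∈ Icc (-s) (-t), -x ∈ S := fun x hx =>
      hsub ⟨by linarith [hx.2], by linarith [hx.1]⟩
    have key : ∀ k : ℝ → E, (∀ t ∈ S, HasDerivAt k (F (k t)) t) → ∀ x ∈ Icc (-s) (-t),
        HasDerivAt (fun x => k (-x)) ((-F) (k (-x))) x := fun k hk x hx => by
      simpa [Function.comp_def] using (hk (-x) (hmem x hx)).scomp x (hasDerivAt_neg x)
    have := ode_unique_right hF.neg
      (fun x hx => (key f hf x hx).continuousAt.continuousWithinAt)
      (fun x hx => (key f hf x (Ico_subset_Icc_self hx)).hasDerivWithinAt)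
      (fun x hx => (key g hg x hx).continuousAt.continuousWithinAt)
      (fun x hx => (key g hg x (Ico_subset_Icc_self hx)).hasDerivWithinAt) (by simpa using h)
      (right_mem_Icc.2 (neg_le_neg hst))
    simpa using this

/-- Local existence gives a time uniform on a small ball; compactness makes it uniform on `K`, and
autonomy makes it independent of `t₀`. -/
theorem exists_uniform_time {F : E → E} (hF : ContDiff ℝ 1 F) {K : Set E} (hK : IsCompact K) :
    ∃ δ > (0 : ℝ), ∀ x ∈ K, ∀ t₀ : ℝ, ∃ α : ℝ → E, α t₀ = x ∧
      ∀ t ∈ Ioo (t₀ - δ) (t₀ + δ), HasDerivAt α (F (α t)) t := by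
  have h0 : ∃ δ > (0 : ℝ), ∀ x ∈ K, ∃ α : ℝ → E, α 0 = x ∧
      ∀ t ∈ Ioo (-δ) δ, HasDerivAt α (F (α t)) t := by
    refine hK.induction_on (p := fun K => ∃ δ > (0 : ℝ), ∀ x ∈ K, ∃ α : ℝ → E, α 0 = x ∧
      ∀ t ∈ Ioo (-δ) δ, HasDerivAt α (F (α t)) t) ⟨1, one_pos, by simp⟩ ?_ ?_ ?_
    · rintro s t hst ⟨δ, hδ, h⟩
      exact ⟨δ, hδ, fun x hx => h x (hst hx)⟩
    · rintro s t ⟨δ, hδ, h⟩ ⟨δ', hδ', h'⟩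
      refine ⟨min δ δ', lt_min hδ hδ', fun x hx => ?_⟩
      rcases hx with hx | hx
      · obtain ⟨α, h1, h2⟩ := h x hx
        exact ⟨α, h1, fun t ht => h2 t ⟨by linarith [ht.1, min_le_left δ δ'],
          by linarith [ht.2, min_le_left δ δ']⟩⟩
      · obtain ⟨α, h1, h2⟩ := h' x hx
        exact ⟨α, h1, fun t ht => h2 t ⟨by linarith [ht.1, min_le_right δ δ'],
          by linarith [ht.2, min_le_right δ δ']⟩⟩
    · intro x _
      obtain ⟨ρ, hρ, δ, hδ, h⟩ :=
        hF.contDiffAt.exists_forall_mem_closedBall_exists_eq_forall_mem_Ioo_hasDerivAt (x₀ := x) 0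
      refine ⟨Metric.closedBall x ρ, mem_nhdsWithin_of_mem_nhds (Metric.closedBall_mem_nhds x hρ),
        δ, hδ, ?_⟩
      simpa using h
  obtain ⟨δ, hδ, h⟩ := h0
  refine ⟨δ, hδ, fun x hx t₀ => ?_⟩
  obtain ⟨α, h1, h2⟩ := h x hx
  refine ⟨fun t => α (t - t₀), by simpa using h1, fun t ht => ?_⟩
  exact (h2 (t - t₀) ⟨by linarith [ht.1], by linarith [ht.2]⟩).comp_sub_const t t₀

/-- A solution on a half-line all of whose extensions stay in a fixed compact set is global. -/
theorem exists_global_extension {F : E → E} (hF : ContDiff ℝ 1 F) {K : Set E} (hK : IsCompact K)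
    {b : ℝ} {γ : ℝ → E} (hγ : ∀ s ∈ Iio b, HasDerivAt γ (F (γ s)) s)
    (hbd : ∀ b' ≥ b, ∀ γ' : ℝ → E, EqOn γ' γ (Iio b) →
      (∀ s ∈ Iio b', HasDerivAt γ' (F (γ' s)) s) → ∀ s ∈ Iio b', γ' s ∈ K) :
    ∃ γ' : ℝ → E, EqOn γ' γ (Iio b) ∧ ∀ s, HasDerivAt γ' (F (γ' s)) s := by
  obtain ⟨δ, hδ, hloc⟩ := exists_uniform_time hF hK
  -- Each step restarts `δ / 4` before the current end `c`. The local solution reaches `c + 3δ / 4`,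
  -- so a gain of `δ / 2` is safe.
  have step : ∀ n : ℕ, ∃ γ' : ℝ → E, EqOn γ' γ (Iio b) ∧
      ∀ s ∈ Iio (b + n * (δ / 2)), HasDerivAt γ' (F (γ' s)) s := by
    intro n
    induction n with
    | zero => exact ⟨γ, fun _ _ => rfl, by simpa using hγ⟩
    | succ n ih =>
      obtain ⟨γ₁, h1, h2⟩ := ih
      set c := b + n * (δ / 2) with hc
      have hbc : b ≤ c := by
        rw [hc]; nlinarith [mul_nonneg (Nat.cast_nonneg (α := ℝ) n) hδ.le]
      obtain ⟨α, h3, h4⟩ := hloc (γ₁ (c - δ / 4))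
        (hbd c hbc γ₁ h1 h2 _ (by simp only [mem_Iio]; linarith)) (c - δ / 4)
      have h5 : EqOn γ₁ α (Ioo (c - δ) c) := ode_unique hF ordConnected_Ioo
        (fun t ht => h2 t ht.2)
        (fun t ht => h4 t ⟨by linarith [ht.1], by linarith [ht.2]⟩)
        (s := c - δ / 4) ⟨by linarith, by linarith⟩ h3.symm
      set γ₂ : ℝ → E := fun s => if s < c then γ₁ s else α s with hγ₂
      have h6 : EqOn γ₂ α (Ioi (c - δ)) := fun t ht => by
        by_cases h : t < c
        · simp only [hγ₂, if_pos h]; exact h5 ⟨ht, h⟩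
        · simp only [hγ₂, if_neg h]
      have h7 : EqOn γ₂ γ₁ (Iio c) := fun t ht => if_pos ht
      refine ⟨γ₂, fun t ht => (h7 (lt_of_lt_of_le ht hbc)).trans (h1 ht), fun t ht => ?_⟩
      have ht' : t < c + δ / 2 := by
        have : t < b + (n + 1 : ℕ) * (δ / 2) := ht
        push_cast at this; rw [hc]; linarith
      by_cases h : t < c
      · rw [h7 h]
        exact (h2 t h).congr_of_eventuallyEq (h7.eventuallyEq_of_mem (Iio_mem_nhds h))
      · have hm : c - δ < t := by linarith
        rw [h6 hm]
        exact (h4 t ⟨by linarith, by linarith⟩).congr_of_eventuallyEq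
          (h6.eventuallyEq_of_mem (Ioi_mem_nhds hm))
  choose G hG1 hG2 using step
  set B : ℕ → ℝ := fun n => b + n * (δ / 2) with hB
  have hagree : ∀ m n, ∀ s, s < B m → s < B n → G m s = G n s := fun m n s hm hn =>
    ode_unique hF (S := Iio (min (B m) (B n))) ordConnected_Iio
      (fun t ht => hG2 m t (lt_min_iff.1 (mem_Iio.1 ht)).1)
      (fun t ht => hG2 n t (lt_min_iff.1 (mem_Iio.1 ht)).2)
      (s := b - 1) (by
        have hpos : ∀ k, b ≤ B k := fun k => le_add_of_nonneg_right (by positivity)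
        exact lt_min ((sub_one_lt b).trans_le (hpos m)) ((sub_one_lt b).trans_le (hpos n)))
      (by rw [hG1 m (by simp), hG1 n (by simp)]) (lt_min hm hn)
  have hex : ∀ s : ℝ, ∃ n, s < B n := fun s => by
    obtain ⟨n, hn⟩ := exists_nat_gt ((s - b) / (δ / 2))
    refine ⟨n, ?_⟩
    rw [div_lt_iff₀ (by positivity)] at hn
    simp only [hB]; linarith
  choose N hN using hex
  refine ⟨fun s => G (N s) s, fun s hs => hG1 _ hs, fun s => ?_⟩
  refine (hG2 (N s) s (hN s)).congr_of_eventuallyEq ?_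
  filter_upwards [Iio_mem_nhds (hN s)] with t ht using hagree _ _ t (hN t) ht

end ODE

end

/-! ### Averaging and integration operators on `C([0, 1])`. -/

section

/-- The Banach algebra of continuous functions on `[0, 1]`. -/
abbrev CI : Type := C(unitInterval, ℝ)

/-- The nearest point of `[0, 1]`. -/
noncomputable def clamp (x : ℝ) : unitInterval := projIcc 0 1 zero_le_one x

theorem continuous_clamp : Continuous clamp :=
  continuous_projIcc (h := zero_le_one)

theorem clamp_of_mem {x : ℝ} (hx : x ∈ Icc (0 : ℝ) 1) : clamp x = ⟨x, hx⟩ := projIcc_of_mem _ hx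

theorem clamp_val (t : unitInterval) : clamp t = t := projIcc_val _ t

/-- The identity function of `[0, 1]`. -/
def idCI : CI := ⟨Subtype.val, continuous_subtype_val⟩

@[simp] theorem idCI_apply (t : unitInterval) : idCI t = t := rfl

/-- The averaging operator `u ↦ (t ↦ ∫₀¹ σᵏ u(σ t) dσ)`, which inverts `t d/dt + k + 1`. -/
noncomputable def avg (k : ℕ) : CI →L[ℝ] CI :=
  LinearMap.mkContinuous
    { toFun := fun u => ⟨fun t => ∫ σ in (0 : ℝ)..1, σ ^ k * u (clamp (σ * t)), by
        apply intervalIntegral.continuous_parametric_intervalIntegral_of_continuous'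
        exact (continuous_snd.pow k).mul (u.continuous.comp (continuous_clamp.comp
          (continuous_snd.mul (continuous_subtype_val.comp continuous_fst))))⟩
      map_add' := fun u v => by
        ext t
        simp only [ContinuousMap.coe_mk, ContinuousMap.add_apply, mul_add]
        apply intervalIntegral.integral_add
        · exact ((continuous_id.pow k).mul (u.continuous.comp (continuous_clamp.comp
            (continuous_id.mul continuous_const)))).intervalIntegrable _ _
        · exact ((continuous_id.pow k).mul (v.continuous.comp (continuous_clamp.comp
            (continuous_id.mul continuous_const)))).intervalIntegrable _ _
      map_smul' := fun c u => by
        ext t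
        simp only [ContinuousMap.coe_mk, ContinuousMap.smul_apply, smul_eq_mul, RingHom.id_apply]
        rw [← intervalIntegral.integral_const_mul]
        congr 1 with σ
        ring } 1 (fun u => by
      rw [one_mul, ContinuousMap.norm_le _ (norm_nonneg u)]
      intro t
      have := intervalIntegral.norm_integral_le_of_norm_le_const (a := 0) (b := 1)
        (f := fun σ : ℝ => σ ^ k * u (clamp (σ * t))) (C := ‖u‖) (fun σ hσ => by
          rw [uIoc_of_le zero_le_one] at hσ
          rw [norm_mul, norm_pow, Real.norm_of_nonneg hσ.1.le]
          exact (mul_le_of_le_one_left (norm_nonneg _) (pow_le_one₀ hσ.1.le hσ.2)).trans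
            (u.norm_coe_le_norm _))
      simpa using this)

theorem avg_apply (k : ℕ) (u : CI) (t : unitInterval) :
    avg k u t = ∫ σ in (0 : ℝ)..1, σ ^ k * u (clamp (σ * t)) := rfl

theorem avg_zero (k : ℕ) (u : CI) : avg k u 0 = u 0 / (k + 1) := by
  have h : ∀ σ : ℝ, clamp (σ * (0 : unitInterval)) = 0 := fun σ => by
    have := clamp_val 0
    simpa using this
  rw [avg_apply]
  simp_rw [h]
  rw [intervalIntegral.integral_mul_const, integral_pow]
  simp
  ring

/-- Substitution `τ = σ t`, in a form without division, valid also at `t = 0`. -/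
theorem pow_mul_avg (k : ℕ) (u : CI) {t : ℝ} (ht : t ∈ Icc (0 : ℝ) 1) :
    t ^ (k + 1) * avg k u (clamp t) = ∫ τ in (0 : ℝ)..t, τ ^ k * u (clamp τ) := by
  have h := intervalIntegral.smul_integral_comp_mul_right (a := 0) (b := 1)
    (fun τ : ℝ => τ ^ k * u (clamp τ)) t
  simp only [zero_mul, one_mul, smul_eq_mul] at h
  rw [← h, avg_apply, clamp_of_mem ht, pow_succ', mul_assoc, ← intervalIntegral.integral_const_mul]
  congr 1
  congr 1 with σ
  ring

theorem hasDerivAt_avg (k : ℕ) (u : CI) {t : ℝ} (ht : t ∈ Ioo (0 : ℝ) 1) :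
    HasDerivAt (fun t => avg k u (clamp t))
      ((u (clamp t) - (k + 1) * avg k u (clamp t)) / t) t := by
  have hc : Continuous fun τ : ℝ => τ ^ k * u (clamp τ) :=
    (continuous_id.pow k).mul (u.continuous.comp continuous_clamp)
  have h1 := (hc.integral_hasStrictDerivAt 0 t).hasDerivAt
  have ht0 : t ≠ 0 := ht.1.ne'
  have h2 := h1.div (hasDerivAt_pow (k + 1) t) (pow_ne_zero _ ht0)
  have h3 : (fun t => avg k u (clamp t)) =ᶠ[𝓝 t]
      fun t => (∫ τ in (0 : ℝ)..t, τ ^ k * u (clamp τ)) / t ^ (k + 1) := by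
    filter_upwards [Ioo_mem_nhds ht.1 ht.2] with x hx
    rw [eq_div_iff (pow_ne_zero _ hx.1.ne'), mul_comm, pow_mul_avg k u (Ioo_subset_Icc_self hx)]
  refine (h2.congr_of_eventuallyEq h3).congr_deriv ?_
  rw [← pow_mul_avg k u (Ioo_subset_Icc_self ht)]
  push_cast
  field_simp
  ring

/-- The integral operator `u ↦ (t ↦ ∫₀ᵗ u)`. -/
noncomputable def volterra : CI →L[ℝ] CI := (ContinuousLinearMap.mul ℝ CI idCI).comp (avg 0)

theorem volterra_apply (u : CI) {t : ℝ} (ht : t ∈ Icc (0 : ℝ) 1) :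
    volterra u (clamp t) = ∫ τ in (0 : ℝ)..t, u (clamp τ) := by
  have := pow_mul_avg 0 u ht
  simp only [zero_add, pow_one, pow_zero, one_mul] at this
  rw [← this]
  simp [volterra, clamp_of_mem ht]

end

/-! ### The system on paths, and analytic dependence on initial data for short times. -/

section

variable {r : ℕ}

/-- Continuous paths `[0, 1] → Phase r`, as a product of Banach algebras. -/
abbrev Path (r : ℕ) : Type := CI × (Fin r → CI) × (Fin r → CI)

/-- The field of the system, acting on paths. -/
noncomputable def pathField (d : Fin r → ℕ) (ε : ℝ) (z : Path r) : Path r :=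
  (z.1 * ((∑ j, z.2.1 j ^ 2) - (ε / 2) • z.1 ^ 2),
   fun i => z.2.1 i * ((∑ j, z.2.1 j ^ 2) - 1) + (1 / √(d i)) • z.2.2 i ^ 2
      + (ε / 2) • ((algebraMap ℝ CI √(d i) - z.2.1 i) * z.1 ^ 2),
   fun i => z.2.2 i * ((∑ j, z.2.1 j ^ 2) - (1 / √(d i)) • z.2.1 i - (ε / 2) • z.1 ^ 2))

/-- Evaluation of a path. -/
noncomputable def evPath (t : unitInterval) : Path r →L[ℝ] Phase r :=
  let e : CI →L[ℝ] ℝ := ContinuousMap.evalCLM ℝ t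
  e.prodMap ((ContinuousLinearMap.piMap fun _ => e).prodMap (ContinuousLinearMap.piMap fun _ => e))

theorem evPath_apply (t : unitInterval) (z : Path r) :
    evPath t z = (z.1 t, fun i => z.2.1 i t, fun i => z.2.2 i t) := rfl

/-- Constant paths. -/
noncomputable def constPath : Phase r →L[ℝ] Path r :=
  let e : ℝ →L[ℝ] CI := Algebra.linearMap ℝ CI |>.toContinuousLinearMap
  e.prodMap ((ContinuousLinearMap.piMap fun _ => e).prodMap (ContinuousLinearMap.piMap fun _ => e))

theorem constPath_apply (x : Phase r) : constPath x =
    (algebraMap ℝ CI x.1, fun i => algebraMap ℝ CI (x.2.1 i), fun i => algebraMap ℝ CI (x.2.2 i)) :=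
  rfl

/-- Componentwise integration of paths. -/
noncomputable def intPath : Path r →L[ℝ] Path r :=
  volterra.prodMap ((ContinuousLinearMap.piMap fun _ => volterra).prodMap
    (ContinuousLinearMap.piMap fun _ => volterra))

theorem intPath_apply (z : Path r) : intPath z =
    (volterra z.1, fun i => volterra (z.2.1 i), fun i => volterra (z.2.2 i)) := rfl

theorem evPath_constPath (t : unitInterval) (x : Phase r) : evPath t (constPath x) = x := by
  simp [evPath_apply, constPath_apply, algebraMap_apply]

theorem evPath_pathField (d : Fin r → ℕ) (ε : ℝ) (t : unitInterval) (z : Path r) :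
    evPath t (pathField d ε z) = field d ε (evPath t z) := by
  simp only [evPath_apply, pathField, field, cW, cX, cY]
  refine Prod.ext ?_ (Prod.ext ?_ ?_)
  · simp [ContinuousMap.sum_apply]
  · funext i
    simp [ContinuousMap.sum_apply, algebraMap_apply]
    ring
  · funext i
    simp only [ContinuousMap.mul_apply, ContinuousMap.sub_apply, ContinuousMap.sum_apply,
      ContinuousMap.pow_apply, ContinuousMap.smul_apply, smul_eq_mul]
    ring

theorem contDiff_field (d : Fin r → ℕ) (ε : ℝ) {n : WithTop ℕ∞} : ContDiff ℝ n (field d ε) := by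
  unfold field cW cX cY
  fun_prop

theorem contDiff_pathField (d : Fin r → ℕ) (ε : ℝ) {n : WithTop ℕ∞} :
    ContDiff ℝ n (pathField d ε) := by
  unfold pathField
  fun_prop

/-- The derivative of `t ↦ ∫₀ᵗ z`, for a path `z`. -/
theorem hasDerivWithinAt_intPath (z : Path r) {t : ℝ} (ht : t ∈ Icc (0 : ℝ) 1) :
    HasDerivWithinAt (fun t => evPath (clamp t) (intPath z)) (evPath (clamp t) z)
      (Icc 0 1) t := by
  have key : ∀ u : CI, HasDerivWithinAt (fun t => volterra u (clamp t)) (u (clamp t))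
      (Icc 0 1) t := fun u =>
    ((u.continuous.comp continuous_clamp).integral_hasStrictDerivAt 0 t).hasDerivAt.hasDerivWithinAt
      |>.congr (fun x hx => volterra_apply u hx) (volterra_apply u ht)
  exact (key z.1).prodMk ((hasDerivWithinAt_pi.2 fun i => key (z.2.1 i)).prodMk
    (hasDerivWithinAt_pi.2 fun i => key (z.2.2 i)))

/-- The real-analytic inverse function theorem. -/
theorem exists_analytic_local_inverse {E F : Type*} [NormedAddCommGroup E] [NormedSpace ℝ E]
    [CompleteSpace E] [NormedAddCommGroup F] [NormedSpace ℝ F] {f : E → F} (hf : ContDiff ℝ ω f)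
    {e : E ≃L[ℝ] F} {a : E} (hf' : HasFDerivAt f (e : E →L[ℝ] F) a) :
    ∃ g : F → E, ContDiffAt ℝ ω g (f a) ∧ g (f a) = a ∧ ∀ᶠ y in 𝓝 (f a), f (g y) = y :=
  have h := hf.contDiffAt (x := a)
  ⟨h.localInverse hf' (by simp), h.to_localInverse hf' (by simp),
    h.localInverse_apply_image hf' (by simp),
    (h.hasStrictFDerivAt' hf' (by simp)).eventually_right_inverse⟩

/-- The shear `(h, z) ↦ (h, z - h w)`. -/
noncomputable def shear {E : Type*} [NormedAddCommGroup E] [NormedSpace ℝ E] (w : E) :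
    (ℝ × E) ≃L[ℝ] (ℝ × E) :=
  ContinuousLinearEquiv.equivOfInverse
    ((ContinuousLinearMap.fst ℝ ℝ E).prod (ContinuousLinearMap.snd ℝ ℝ E -
      (ContinuousLinearMap.fst ℝ ℝ E).smulRight w))
    ((ContinuousLinearMap.fst ℝ ℝ E).prod (ContinuousLinearMap.snd ℝ ℝ E +
      (ContinuousLinearMap.fst ℝ ℝ E).smulRight w))
    (fun q => by simp) (fun q => by simp)

theorem hasFDerivAt_shear {E : Type*} [NormedAddCommGroup E] [NormedSpace ℝ E] {f : E → E} {x : E}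
    (hf : DifferentiableAt ℝ f x) :
    HasFDerivAt (fun q : ℝ × E => (q.1, q.2 - q.1 • f q.2))
      (shear (f x) : (ℝ × E) →L[ℝ] (ℝ × E)) (0, x) := by
  have h1 : HasFDerivAt (fun q : ℝ × E => f q.2)
      ((fderiv ℝ f x).comp (ContinuousLinearMap.snd ℝ ℝ E)) (0, x) :=
    HasFDerivAt.comp (0, x) (by exact hf.hasFDerivAt) hasFDerivAt_snd
  have h2 := (hasFDerivAt_fst (𝕜 := ℝ) (p := ((0 : ℝ), x))).prodMk
    ((hasFDerivAt_snd (𝕜 := ℝ) (p := ((0 : ℝ), x))).sub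
      ((hasFDerivAt_fst (𝕜 := ℝ) (p := ((0 : ℝ), x))).smul h1))
  refine h2.congr_fderiv ?_
  ext q <;> simp [shear]

/-- Keeping `h` as a coordinate gives analyticity jointly in `h` and the datum. At `h = 0` the
derivative is a shear, hence invertible whatever the size of `f'`. -/
theorem exists_shear_inverse {E : Type*} [NormedAddCommGroup E] [NormedSpace ℝ E]
    [CompleteSpace E] {f : E → E} (hf : ContDiff ℝ ω f) (x : E) :
    ∃ g : ℝ × E → E, ContDiffAt ℝ ω g (0, x) ∧
      ∀ᶠ y : ℝ × E in 𝓝 (0, x), g y = y.2 + y.1 • f (g y) := by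
  have hG : ContDiff ℝ ω (fun q : ℝ × E => (q.1, q.2 - q.1 • f q.2)) := by fun_prop
  obtain ⟨g, hg, -, hr⟩ := exists_analytic_local_inverse hG
    (hasFDerivAt_shear (hf.differentiable (by simp) x))
  simp only [zero_smul, sub_zero] at hg hr
  refine ⟨fun y => (g y).2, hg.snd, hr.mono fun y hy => ?_⟩
  have h1 := congrArg Prod.fst hy
  have h2 := congrArg Prod.snd hy
  simp only at h1 h2
  rw [← h1, ← h2]
  simp

/-- Smooth dependence on initial data for short times. -/
theorem exists_smooth_flow (d : Fin r → ℕ) (ε : ℝ) (x₀ : Phase r) :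
    ∃ φ : ℝ × Phase r → Phase r, ContDiffAt ℝ ω φ (0, x₀) ∧
      ∀ᶠ q : ℝ × Phase r in 𝓝 (0, x₀), ∀ (γ : ℝ → Phase r) (s : ℝ), γ s = q.2 →
        (∀ t, HasDerivAt γ (field d ε (γ t)) t) → γ (s + q.1) = φ q := by
  -- A path with `y = x + h ∫ F(y)` solves `y' = h F(y)` on `[0, 1]`: it is a trajectory over time
  -- `h`, of either sign, run in unit time. Uniqueness below identifies it with `t ↦ γ (s + h t)`.
  obtain ⟨inv, hloc, hright⟩ := exists_shear_inverse
    (intPath.contDiff.comp (contDiff_pathField (n := ω) d ε)) (constPath x₀)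
  set ι : ℝ × Phase r → ℝ × Path r := fun q => (q.1, constPath q.2)
  have hι : ContDiff ℝ ω ι := by fun_prop
  refine ⟨fun q => evPath 1 (inv (ι q)), ?_, ?_⟩
  · have : ContDiffAt ℝ ω (fun q => inv (ι q)) (0, x₀) :=
      ContDiffAt.comp (0, x₀) (by exact hloc) hι.contDiffAt
    exact (evPath 1).contDiff.contDiffAt.comp (0, x₀) this
  · filter_upwards [hι.continuous.continuousAt (x := (0, x₀)) |>.eventually hright]
      with ⟨h, x⟩ hq γ s hγs hγ
    simp only at hγs ⊢
    set y := inv (ι (h, x)) with hy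
    have hy2 : y = constPath x + h • intPath (pathField d ε y) := hq
    have hz : ∀ t ∈ Icc (0 : ℝ) 1, HasDerivWithinAt (fun t => evPath (clamp t) y)
        ((h • field d ε) (evPath (clamp t) y)) (Icc 0 1) t := by
      intro t ht
      have h1 := ((hasDerivWithinAt_intPath (pathField d ε y) ht).const_smul h).const_add x
      rw [evPath_pathField] at h1
      refine h1.congr_of_mem (fun t _ => ?_) ht
      conv_lhs => rw [hy2]
      simp [evPath_constPath]
    have hc : ∀ t : ℝ, HasDerivAt (fun t => γ (s + h * t)) ((h • field d ε) (γ (s + h * t))) t :=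
      fun t => (hγ (s + h * t)).scomp t (((hasDerivAt_id t).const_mul h).const_add s
        |>.congr_deriv (mul_one h))
    have huniq := ode_unique_right ((contDiff_field (n := 1) d ε).const_smul h)
      (f := fun t => γ (s + h * t)) (g := fun t => evPath (clamp t) y) (a := 0) (b := 1)
      (fun t _ => (hc t).continuousAt.continuousWithinAt)
      (fun t _ => (hc t).hasDerivWithinAt)
      (fun t ht => (hz t ht).continuousWithinAt)
      (fun t ht => (hz t (Ico_subset_Icc_self ht)).mono_of_mem_nhdsWithin
        (Icc_mem_nhdsGE_of_mem ht)) (by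
          have h0 : clamp 0 = 0 := clamp_val 0
          have hint : evPath 0 (intPath (pathField d ε y)) = 0 := by
            simp [evPath_apply, intPath_apply, volterra]
            rfl
          simp only [mul_zero, add_zero, h0, hγs]
          rw [hy2, map_add, map_smul, hint, evPath_constPath]
          simp) (right_mem_Icc.2 zero_le_one)
    have h1 : clamp 1 = 1 := clamp_val 1
    simpa [h1] using huniq

end

/-! ### Evolution of `Q` and `H`, the invariant region and its bounds. -/

section

variable {r : ℕ} {d : Fin r → ℕ} {ε : ℝ}

/-- The cross terms `X_i Y_i² / √d_i` cancel between the `X` and `Y` equations. The identity is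
algebraic, with no solution in sight, because it is also used backwards: to recover the equation of
`Y₁` from that of `Q`. -/
theorem calQ_field (d : Fin r → ℕ) (ε : ℝ) (z : Phase r) :
    (∑ i, (2 * cX z i * cX (field d ε z) i + 2 * cY z i * cY (field d ε z) i))
      + ε * ((∑ i, (d i : ℝ)) - 1) * cW z * cW (field d ε z) =
    2 * ((∑ j, cX z j ^ 2) - ε / 2 * cW z ^ 2) * calQ d ε z
        + ε * cW z ^ 2 * (calH d z - 1) := by
  set S := ∑ j, cX z j ^ 2 with hS
  have h2 : ∀ i, 2 * cX z i * cX (field d ε z) i + 2 * cY z i * cY (field d ε z) i =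
      cX z i ^ 2 * (2 * (S - 1 - ε / 2 * cW z ^ 2))
        + √(d i) * cX z i * (ε * cW z ^ 2)
        + cY z i ^ 2 * (2 * (S - ε / 2 * cW z ^ 2)) := fun i => by
    have h3 : cX (field d ε z) i = cX z i * (S - 1) + cY z i ^ 2 / √(d i)
      + ε / 2 * (√(d i) - cX z i) * cW z ^ 2 := rfl
    have h4 : cY (field d ε z) i = cY z i * (S - cX z i / √(d i) - ε / 2 * cW z ^ 2) := rfl
    rw [h3, h4]
    ring
  have h5 : cW (field d ε z) = cW z * (S - ε / 2 * cW z ^ 2) := rfl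
  simp_rw [h2, h5]
  simp only [Finset.sum_add_distrib, ← Finset.sum_mul, ← hS, calH, calQ, calL]
  ring

theorem differentiable_calQ : Differentiable ℝ (calQ (r := r) d ε) := by
  unfold calQ calL cW cX cY
  fun_prop

section Components

variable {γ : ℝ → Phase r} {s : ℝ}

theorem hasDerivAt_cW (h : HasDerivAt γ (field d ε (γ s)) s) :
    HasDerivAt (fun s => cW (γ s))
      (((∑ j, cX (γ s) j ^ 2) - ε / 2 * cW (γ s) ^ 2) * cW (γ s)) s :=
  (hasFDerivAt_fst (𝕜 := ℝ)).comp_hasDerivAt s h |>.congr_deriv (mul_comm _ _)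

theorem hasDerivAt_cX (h : HasDerivAt γ (field d ε (γ s)) s) (i : Fin r) :
    HasDerivAt (fun s => cX (γ s) i) (cX (field d ε (γ s)) i) s :=
  hasDerivAt_pi.1 (hasFDerivAt_fst (𝕜 := ℝ).comp_hasDerivAt s
    (hasFDerivAt_snd (𝕜 := ℝ).comp_hasDerivAt s h)) i

theorem hasDerivAt_cY (h : HasDerivAt γ (field d ε (γ s)) s) (i : Fin r) :
    HasDerivAt (fun s => cY (γ s) i)
      (((∑ j, cX (γ s) j ^ 2) - cX (γ s) i / √(d i) - ε / 2 * cW (γ s) ^ 2) * cY (γ s) i) s :=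
  (hasDerivAt_pi.1 (hasFDerivAt_snd (𝕜 := ℝ).comp_hasDerivAt s
    (hasFDerivAt_snd (𝕜 := ℝ).comp_hasDerivAt s h)) i).congr_deriv (mul_comm _ _)

/-- The weights `√d_i` turn `Y_i² / √d_i` into `Y_i²` and `√d_i W²` into `d_i W²`, and the sums
reassemble into `Q`. -/
theorem hasDerivAt_calH (hd : ∀ i, 0 < d i) (h : HasDerivAt γ (field d ε (γ s)) s) :
    HasDerivAt (fun s => calH d (γ s) - 1)
      (((∑ j, cX (γ s) j ^ 2) - 1 - ε / 2 * cW (γ s) ^ 2) * (calH d (γ s) - 1)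
        + calQ d ε (γ s)) s := by
  have h1 := (HasDerivAt.fun_sum (u := Finset.univ) fun i _ =>
    (hasDerivAt_cX h i).const_mul √(d i)).sub_const (1 : ℝ)
  refine h1.congr_deriv ?_
  have h2 : ∀ i, √(d i) * cX (field d ε (γ s)) i =
      √(d i) * cX (γ s) i * ((∑ j, cX (γ s) j ^ 2) - 1 - ε / 2 * cW (γ s) ^ 2) + cY (γ s) i ^ 2
        + (d i : ℝ) * (ε / 2 * cW (γ s) ^ 2) := fun i => by
    have hpos : 0 < √(d i : ℝ) := Real.sqrt_pos.2 (by exact_mod_cast hd i)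
    have hsq : √(d i : ℝ) * √(d i) = d i := Real.mul_self_sqrt (by positivity)
    have hdiv : √(d i : ℝ) * (cY (γ s) i ^ 2 / √(d i)) = cY (γ s) i ^ 2 := by field_simp
    have : cX (field d ε (γ s)) i = cX (γ s) i * ((∑ j, cX (γ s) j ^ 2) - 1)
      + cY (γ s) i ^ 2 / √(d i) + ε / 2 * (√(d i) - cX (γ s) i) * cW (γ s) ^ 2 := rfl
    rw [this]
    linear_combination hdiv + ε / 2 * cW (γ s) ^ 2 * hsq
  simp_rw [h2]
  rw [Finset.sum_add_distrib, Finset.sum_add_distrib, ← Finset.sum_mul, ← Finset.sum_mul]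
  simp only [calH, calQ, calL, Finset.sum_add_distrib]
  ring

theorem hasDerivAt_calQ (h : HasDerivAt γ (field d ε (γ s)) s) :
    HasDerivAt (fun s => calQ d ε (γ s))
      (2 * ((∑ j, cX (γ s) j ^ 2) - ε / 2 * cW (γ s) ^ 2) * calQ d ε (γ s)
        + ε * cW (γ s) ^ 2 * (calH d (γ s) - 1)) s := by
  have h1 := ((HasDerivAt.fun_sum (u := Finset.univ) fun i _ =>
    ((hasDerivAt_cX h i).pow 2).add ((hasDerivAt_cY h i).pow 2)).sub_const (1 : ℝ)).add
    (((hasDerivAt_cW h).pow 2).const_mul (ε / 2 * ((∑ i, (d i : ℝ)) - 1)))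
  refine h1.congr_deriv ?_
  rw [← calQ_field]
  congr 1
  · refine Finset.sum_congr rfl fun i _ => ?_
    have h4 : cY (field d ε (γ s)) i = cY (γ s) i *
      ((∑ j, cX (γ s) j ^ 2) - cX (γ s) i / √(d i) - ε / 2 * cW (γ s) ^ 2) := rfl
    rw [h4, show 2 - 1 = 1 from rfl]
    push_cast
    ring
  · rw [show 2 - 1 = 1 from rfl]
    simp only [field, cW]
    push_cast
    ring

end Components

/-- The inequalities that define the region swept out by the trajectories. -/
def InRegion (d : Fin r → ℕ) (ε : ℝ) (z : Phase r) : Prop :=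
  (0 < cW z ∧ ∀ i, 0 < cY z i) ∧ calH d z < 1 ∧ calQ d ε z < 0

/-- `Q` and `H - 1` form a cooperative pair with couplings `ε W²` and `1`; `W` and each `Y_i` solve
homogeneous linear equations and keep their sign. -/
theorem InRegion.forward_invariant (hd : ∀ i, 0 < d i) (hε : 0 < ε) {γ : ℝ → Phase r} {s₀ s₁ : ℝ}
    (h01 : s₀ ≤ s₁) (hγ : ∀ s ∈ Icc s₀ s₁, HasDerivAt γ (field d ε (γ s)) s)
    (h0 : InRegion d ε (γ s₀)) : InRegion d ε (γ s₁) := by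
  have hc : ContinuousOn γ (Icc s₀ s₁) := fun s hs => (hγ s hs).continuousAt.continuousWithinAt
  have hW : ContinuousOn (fun s => cW (γ s)) (Icc s₀ s₁) := continuous_fst.comp_continuousOn hc
  have hX : ∀ i, ContinuousOn (fun s => cX (γ s) i) (Icc s₀ s₁) := fun i =>
    ((continuous_apply i).comp (continuous_fst.comp continuous_snd)).comp_continuousOn hc
  have hQH := neg_of_hasDerivAt_coupled (f := fun s => calQ d ε (γ s))
    (g := fun s => calH d (γ s) - 1) h01
    (a := fun s => 2 * ((∑ j, cX (γ s) j ^ 2) - ε / 2 * cW (γ s) ^ 2))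
    (b := fun s => (∑ j, cX (γ s) j ^ 2) - 1 - ε / 2 * cW (γ s) ^ 2)
    (c := fun s => ε * cW (γ s) ^ 2)
    (by fun_prop) (by fun_prop) (fun s _ => by positivity)
    (fun s hs => hasDerivAt_calQ (hγ s hs)) (fun s hs => hasDerivAt_calH hd (hγ s hs))
    h0.2.2 (sub_neg.2 h0.2.1)
  refine ⟨⟨?_, fun i => ?_⟩, sub_neg.1 hQH.2, hQH.1⟩
  · exact pos_of_hasDerivAt_linear h01
      (a := fun s => (∑ j, cX (γ s) j ^ 2) - ε / 2 * cW (γ s) ^ 2) (by fun_prop)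
      (fun s hs => hasDerivAt_cW (hγ s hs)) h0.1.1
  · exact pos_of_hasDerivAt_linear h01 (f := fun s => cY (γ s) i)
      (a := fun s => (∑ j, cX (γ s) j ^ 2) - cX (γ s) i / √(d i) - ε / 2 * cW (γ s) ^ 2)
      (by fun_prop) (fun s hs => hasDerivAt_cY (hγ s hs) i) (h0.1.2 i)

section Bounds

variable [NeZero r]

theorem two_le_sum (hd1 : 1 < d 0) : (2 : ℝ) ≤ ∑ i, (d i : ℝ) := by
  have : d 0 ≤ ∑ i, d i := Finset.single_le_sum (fun i _ => Nat.zero_le _) (Finset.mem_univ 0)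
  exact_mod_cast hd1.trans_le this

/-- Since `n - 1 ≥ 1` and `L ≥ -1`, `Q < 0` yields `(ε/2) W² ≤ (ε/2)(n - 1) W² < -L ≤ 1`. -/
theorem InRegion.bounds (hd1 : 1 < d 0) (hε : 0 < ε) {z : Phase r} (h : InRegion d ε z) :
    calL z < 0 ∧ cW z < √(2 / ε) := by
  have hn := two_le_sum hd1
  have hQ := h.2.2
  have hL : -1 ≤ calL z := by
    have : 0 ≤ ∑ i, (cX z i ^ 2 + cY z i ^ 2) := Finset.sum_nonneg fun i _ => by positivity
    simp only [calL]; linarith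
  rw [calQ] at hQ
  have h1 : ε / 2 * cW z ^ 2 ≤ ε / 2 * ((∑ i, (d i : ℝ)) - 1) * cW z ^ 2 := by
    have : 0 ≤ ε / 2 * cW z ^ 2 := by positivity
    nlinarith
  refine ⟨by nlinarith [show 0 ≤ ε / 2 * cW z ^ 2 by positivity], Real.lt_sqrt_of_sq_lt ?_⟩
  rw [lt_div_iff₀ hε]
  linarith

theorem InRegion.mem_closedBall (hd1 : 1 < d 0) (hε : 0 < ε) {z : Phase r} (h : InRegion d ε z) :
    z ∈ Metric.closedBall (0 : Phase r) (max 1 √(2 / ε)) := by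
  obtain ⟨hL, hW⟩ := h.bounds hd1 hε
  have hi : ∀ i, cX z i ^ 2 + cY z i ^ 2 ≤ 1 := fun i => by
    have := Finset.single_le_sum (f := fun i => cX z i ^ 2 + cY z i ^ 2)
      (fun i _ => by positivity) (Finset.mem_univ i)
    simp only [calL] at hL
    linarith
  rw [mem_closedBall_zero_iff]
  have hm : (0 : ℝ) ≤ max 1 √(2 / ε) := by positivity
  refine norm_prod_le_iff.2 ⟨?_, norm_prod_le_iff.2 ⟨?_, ?_⟩⟩
  · exact (Real.norm_of_nonneg h.1.1.le).le.trans (hW.le.trans (le_max_right _ _))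
  · refine (pi_norm_le_iff_of_nonneg hm).2 fun i => ?_
    refine (abs_le_one_iff_mul_self_le_one.2 ?_).trans (le_max_left _ _)
    have := hi i; simp only [cX, cY] at this; nlinarith [sq_nonneg (z.2.2 i)]
  · refine (pi_norm_le_iff_of_nonneg hm).2 fun i => ?_
    refine (abs_le_one_iff_mul_self_le_one.2 ?_).trans (le_max_left _ _)
    have := hi i; simp only [cX, cY] at this; nlinarith [sq_nonneg (z.2.1 i)]

/-- Solutions in the region extend to all times, inside the region. -/
theorem exists_extension (hd : ∀ i, 0 < d i) (hd1 : 1 < d 0) (hε : 0 < ε) {b : ℝ}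
    {γ : ℝ → Phase r} (hγ : ∀ s ∈ Iio b, HasDerivAt γ (field d ε (γ s)) s)
    (hreg : ∀ s ∈ Iio b, InRegion d ε (γ s)) :
    ∃ γ' : ℝ → Phase r, EqOn γ' γ (Iio b) ∧ (∀ s, HasDerivAt γ' (field d ε (γ' s)) s) ∧
      ∀ s, InRegion d ε (γ' s) := by
  have hext : ∀ b' ≥ b, ∀ γ' : ℝ → Phase r, EqOn γ' γ (Iio b) →
      (∀ s ∈ Iio b', HasDerivAt γ' (field d ε (γ' s)) s) → ∀ s ∈ Iio b', InRegion d ε (γ' s) := by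
    intro b' hb' γ' heq hsol s hs
    -- Any extension agrees with `γ` at this time, from which invariance carries the region forward
    -- to `s`.
    have hmin : min s (b - 1) ∈ Iio b := (min_le_right _ _).trans_lt (sub_one_lt b)
    refine InRegion.forward_invariant hd hε (min_le_left s (b - 1))
      (fun t ht => hsol t (ht.2.trans_lt hs)) ?_
    rw [heq hmin]
    exact hreg _ hmin
  obtain ⟨γ', h1, h2⟩ := exists_global_extension (contDiff_field d ε)
    (isCompact_closedBall (0 : Phase r) (max 1 √(2 / ε))) hγ
    (fun b' hb' γ' heq hsol s hs => (hext b' hb' γ' heq hsol s hs).mem_closedBall hd1 hε)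
  refine ⟨γ', h1, h2, fun s => hext (max b (s + 1)) (le_max_left _ _) γ' h1 (fun t _ => h2 t) s ?_⟩
  exact lt_max_of_lt_right (lt_add_one s)

end Bounds

end

/-! ### The integral equation in rescaled variables. -/

section

section Quadratic

variable {E F G : Type*} [NormedAddCommGroup E] [NormedSpace ℝ E] [NormedAddCommGroup F]
  [NormedSpace ℝ F] [NormedAddCommGroup G] [NormedSpace ℝ G]

theorem HasFDerivAt.clm_comp_zero (L : F →L[ℝ] G) {f : E → F} {x : E}
    (hf : HasFDerivAt f (0 : E →L[ℝ] F) x) :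
    HasFDerivAt (fun v => L (f v)) (0 : E →L[ℝ] G) x := by
  exact (L.hasFDerivAt.comp x hf).congr_fderiv (by simp)

theorem hasFDerivAt_mul_of_eq_zero {A : Type*} [NormedRing A] [NormedAlgebra ℝ A]
    {f g : E → A} {x : E} (hf : DifferentiableAt ℝ f x) (hg : DifferentiableAt ℝ g x)
    (hf0 : f x = 0) (hg0 : g x = 0) :
    HasFDerivAt (fun v => f v * g v) (0 : E →L[ℝ] A) x := by
  refine (hf.hasFDerivAt.mul' hg.hasFDerivAt).congr_fderiv ?_
  ext
  simp [hf0, hg0]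

end Quadratic

variable {r : ℕ}

/-- The function `k` with `H - 1 = t² k`, in the rescaled variables below. -/
noncomputable def slopeCI (d : Fin r → ℕ) (v : Path r) : CI := ∑ i, √(d i) • v.2.2 i

theorem contDiff_slopeCI (d : Fin r → ℕ) {n : WithTop ℕ∞} : ContDiff ℝ n (slopeCI d) := by
  unfold slopeCI; fun_prop

theorem slopeCI_zero (d : Fin r → ℕ) : slopeCI d (0 : Path r) = 0 := by simp [slopeCI]

variable [NeZero r]

/-- The coordinates `X_i` of the critical point. -/
noncomputable def coefB (d : Fin r → ℕ) (i : Fin r) : ℝ := if i = 0 then beta d else 0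

/-- The coefficient `1 / √d_i` for `i > 1`, and `0` for the distinguished factor. -/
noncomputable def coefY (d : Fin r → ℕ) (i : Fin r) : ℝ := if i = 0 then 0 else 1 / √(d i)

/-- The coefficient of `W²` in the rescaled equation of `X_i`. -/
noncomputable def coefW (d : Fin r → ℕ) (ε : ℝ) (i : Fin r) : ℝ :=
  if i = 0 then ε / 2 * (√(d 0) - beta d - beta d * ((∑ j, (d j : ℝ)) - 1)) else ε / 2 * √(d i)

section Rescaled

variable (d : Fin r → ℕ) (ε : ℝ)

/-! In the rescaled variables `v = (q, u, x)` one has, with `t = exp (s / d₁)`,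
`Q = t² q`, `W = t u₁`, `Y_i = t u_i` for `i > 1`, and `X = X(c) + t² x`. -/

/-- The function `τ` with `∑ X_j² - (ε / 2) W² = 1 / d₁ + t² τ`. -/
noncomputable def tauCI (v : Path r) : CI :=
  (2 * beta d) • v.2.2 0 + idCI ^ 2 * (∑ i, v.2.2 i ^ 2) - (ε / 2) • v.2.1 0 ^ 2

/-- The source of the rescaled equation of `Q`. -/
noncomputable def srcQ (v : Path r) : CI :=
  (2 : ℝ) • (v.1 * tauCI d ε v) + ε • (v.2.1 0 ^ 2 * slopeCI d v)

/-- The source of the rescaled equations of `W` and `Y_i`. -/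
noncomputable def srcU (i : Fin r) (v : Path r) : CI :=
  v.2.1 i * (tauCI d ε v - coefY d i • v.2.2 i)

/-- The quadratic source of the rescaled equations of `X_i`. -/
noncomputable def srcX (i : Fin r) (v : Path r) : CI :=
  idCI ^ 2 * (v.2.2 i * tauCI d ε v) + coefW d ε i • v.2.1 0 ^ 2 + coefY d i • v.2.1 i ^ 2
    - coefB d i • ∑ j ∈ Finset.univ.erase 0, v.2.1 j ^ 2

/-- The operator solving `f' = t² g`, `f(0) = 0`. -/
noncomputable def opLow : CI →L[ℝ] CI :=
  (d 0 : ℝ) • (ContinuousLinearMap.mul ℝ CI (idCI ^ 2)).comp (avg 1)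

/-- The operator solving `f' = g - (1 + 1 / d₁) f`. -/
noncomputable def opHigh : CI →L[ℝ] CI := (d 0 : ℝ) • avg (d 0)

/-- The nonlinear part of the integral equation. -/
noncomputable def nonlin (v : Path r) : Path r :=
  (opLow d (srcQ d ε v), fun i => opLow d (srcU d ε i v),
    fun i => opHigh d (srcX d ε i v + coefB d i • opLow d (srcQ d ε v)))

/-- The linear part of the integral equation, for the initial data `(q(0), u(0))`. -/
noncomputable def dataPath (P : ℝ × (Fin r → ℝ)) : Path r :=
  (algebraMap ℝ CI P.1, fun i => algebraMap ℝ CI (P.2 i),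
    fun i => opHigh d (algebraMap ℝ CI (coefB d i * P.1)))

/-- The square of `Y₁` in terms of the rescaled variables. -/
noncomputable def radCI (v : Path r) : CI :=
  1 + idCI ^ 2 * v.1 - (ε / 2 * ((∑ j, (d j : ℝ)) - 1)) • (idCI * v.2.1 0) ^ 2
    - (∑ i, (algebraMap ℝ CI (coefB d i) + idCI ^ 2 * v.2.2 i) ^ 2)
    - ∑ i ∈ Finset.univ.erase 0, (idCI * v.2.1 i) ^ 2

variable {n : WithTop ℕ∞}

theorem contDiff_tauCI : ContDiff ℝ n (tauCI d ε) := by unfold tauCI; fun_prop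
theorem contDiff_srcQ : ContDiff ℝ n (srcQ d ε) := by
  have := contDiff_tauCI (n := n) d ε
  have := contDiff_slopeCI (n := n) d
  unfold srcQ; fun_prop
theorem contDiff_srcU (i : Fin r) : ContDiff ℝ n (srcU d ε i) := by
  have := contDiff_tauCI (n := n) d ε
  unfold srcU; fun_prop
theorem contDiff_srcX (i : Fin r) : ContDiff ℝ n (srcX d ε i) := by
  have := contDiff_tauCI (n := n) d ε
  unfold srcX; fun_prop
theorem contDiff_nonlin : ContDiff ℝ n (nonlin d ε) := by
  have := contDiff_srcQ (n := n) d ε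
  have := contDiff_srcU (n := n) d ε
  have := contDiff_srcX (n := n) d ε
  unfold nonlin; fun_prop
theorem contDiff_radCI : ContDiff ℝ n (radCI d ε) := by unfold radCI; fun_prop
theorem contDiff_algebraMap : ContDiff ℝ n (algebraMap ℝ CI) :=
  (Algebra.linearMap ℝ CI).toContinuousLinearMap.contDiff
theorem contDiff_dataPath : ContDiff ℝ n (dataPath d) := by
  have := contDiff_algebraMap (n := n)
  unfold dataPath; fun_prop

theorem tauCI_zero : tauCI d ε (0 : Path r) = 0 := by simp [tauCI]
theorem nonlin_zero : nonlin d ε (0 : Path r) = 0 := by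
  simp [nonlin, srcQ, srcU, srcX]
  rfl
theorem dataPath_zero : dataPath d 0 = 0 := by
  simp [dataPath]
  rfl

theorem hasFDerivAt_srcQ : HasFDerivAt (srcQ d ε) (0 : Path r →L[ℝ] CI) 0 := by
  have h1 : HasFDerivAt (fun v : Path r => v.1 * tauCI d ε v) (0 : Path r →L[ℝ] CI) 0 :=
    hasFDerivAt_mul_of_eq_zero (by fun_prop)
      ((contDiff_tauCI (n := 1) d ε).differentiable one_ne_zero 0) rfl (tauCI_zero d ε)
  have h2 : HasFDerivAt (fun v : Path r => v.2.1 0 ^ 2 * slopeCI d v) (0 : Path r →L[ℝ] CI) 0 :=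
    hasFDerivAt_mul_of_eq_zero (by fun_prop)
      ((contDiff_slopeCI (n := 1) d).differentiable one_ne_zero 0) (by simp) (slopeCI_zero d)
  exact ((h1.const_smul (2 : ℝ)).add (h2.const_smul ε)).congr_fderiv (by simp)

theorem hasFDerivAt_srcU (i : Fin r) : HasFDerivAt (srcU d ε i) (0 : Path r →L[ℝ] CI) 0 :=
  hasFDerivAt_mul_of_eq_zero (by fun_prop)
    (((contDiff_tauCI (n := 1) d ε).differentiable one_ne_zero 0).sub (by fun_prop)) rfl
    (by simp [tauCI_zero])

theorem hasFDerivAt_srcX (i : Fin r) : HasFDerivAt (srcX d ε i) (0 : Path r →L[ℝ] CI) 0 := by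
  have h1 : HasFDerivAt (fun v : Path r => v.2.2 i * tauCI d ε v) (0 : Path r →L[ℝ] CI) 0 :=
    hasFDerivAt_mul_of_eq_zero (by fun_prop)
      ((contDiff_tauCI (n := 1) d ε).differentiable one_ne_zero 0) rfl (tauCI_zero d ε)
  have h2 : ∀ j, HasFDerivAt (fun v : Path r => v.2.1 j ^ 2) (0 : Path r →L[ℝ] CI) 0 := fun j => by
    simp_rw [pow_two]
    exact hasFDerivAt_mul_of_eq_zero (by fun_prop) (by fun_prop) rfl rfl
  have h3 := (((HasFDerivAt.clm_comp_zero (ContinuousLinearMap.mul ℝ CI (idCI ^ 2)) h1).add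
    ((h2 0).const_smul (coefW d ε i))).add ((h2 i).const_smul (coefY d i))).sub
    ((HasFDerivAt.fun_sum (u := Finset.univ.erase 0) fun j _ => h2 j).const_smul (coefB d i))
  exact h3.congr_fderiv (by simp)

/-- Every source is a sum of products of factors vanishing at `0`. The one linear coupling, of `q`
into `x`, acts on `q(0)` in `dataPath` and on the already quadratic `q - q(0)` here. -/
theorem hasFDerivAt_nonlin : HasFDerivAt (nonlin d ε) (0 : Path r →L[ℝ] Path r) 0 := by
  have h1 := HasFDerivAt.clm_comp_zero (opLow d) (hasFDerivAt_srcQ d ε)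
  have h2 := fun i => HasFDerivAt.clm_comp_zero (opLow d) (hasFDerivAt_srcU d ε i)
  have h3 := fun i => HasFDerivAt.clm_comp_zero (opHigh d)
    (f := fun v => srcX d ε i v + coefB d i • opLow d (srcQ d ε v))
    (x := 0) (((hasFDerivAt_srcX d ε i).add (h1.const_smul (coefB d i))).congr_fderiv (by simp))
  refine (h1.prodMk ((hasFDerivAt_pi.2 h2).prodMk (hasFDerivAt_pi.2 h3))).congr_fderiv ?_
  ext <;> rfl

/-- The solutions of the integral equation depend analytically on the initial data. -/
theorem exists_local_solutions (hd1 : 1 < d 0) :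
    ∃ v : ℝ × (Fin r → ℝ) → Path r, ContDiffAt ℝ ω v 0 ∧ ∀ᶠ P in 𝓝 0,
      v P = dataPath d P + nonlin d ε (v P) ∧ ∀ t, 0 < radCI d ε (v P) t := by
  have hG : ContDiff ℝ ω (fun v : Path r => v - nonlin d ε v) :=
    contDiff_id.sub (contDiff_nonlin d ε)
  have hG' : HasFDerivAt (fun v : Path r => v - nonlin d ε v)
      (ContinuousLinearEquiv.refl ℝ (Path r) : Path r →L[ℝ] Path r) 0 := by
    refine ((hasFDerivAt_id (0 : Path r)).sub (hasFDerivAt_nonlin d ε)).congr_fderiv ?_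
    ext <;> simp
  obtain ⟨g, hg, hg0, hinv⟩ := exists_analytic_local_inverse hG hG'
  simp only [nonlin_zero, sub_zero] at hg hg0 hinv
  have hι := contDiff_dataPath (n := ω) d
  have hι0 := dataPath_zero d
  have hv : ContDiffAt ℝ ω (fun P => g (dataPath d P)) 0 :=
    ContDiffAt.comp 0 (by rw [hι0]; exact hg) hι.contDiffAt
  refine ⟨fun P => g (dataPath d P), hv, ?_⟩
  have hι1 : Tendsto (dataPath d) (𝓝 0) (𝓝 0) := by
    have := hι.continuous.tendsto 0
    rwa [hι0] at this
  have hrad : ContinuousAt (fun P => radCI d ε (g (dataPath d P))) 0 :=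
    (contDiff_radCI (n := 1) d ε).continuous.continuousAt.comp hv.continuousAt
  have hrad0 : radCI d ε (g (dataPath d 0)) = algebraMap ℝ CI (1 - beta d ^ 2) := by
    rw [hι0, hg0]
    ext t
    simp [radCI, coefB, algebraMap_apply, ContinuousMap.sum_apply]
  -- The value of `Y₁²` at `c`, positive because `d₁ > 1`; closeness in sup norm then keeps `radCI`
  -- positive on all of `[0, 1]`.
  have hpos : 0 < 1 - beta d ^ 2 := by
    have : (1 : ℝ) < d 0 := by exact_mod_cast hd1
    rw [beta, div_pow, one_pow, Real.sq_sqrt (by positivity), sub_pos, div_lt_one (by positivity)]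
    exact this
  have hball := hrad.eventually (Metric.ball_mem_nhds _ hpos)
  filter_upwards [hι1.eventually hinv, hball] with P h1 h2
  refine ⟨sub_eq_iff_eq_add.1 h1, fun t => ?_⟩
  rw [hrad0] at h2
  have h3 := (ContinuousMap.dist_apply_le_dist t).trans_lt h2
  simp only [algebraMap_apply, smul_eq_mul, mul_one, Real.dist_eq] at h3
  linarith [(abs_lt.1 h3).1]

end Rescaled

end

/-! ### From the integral equation back to trajectories for `s < 0`. -/

section

variable {r : ℕ} [NeZero r]

/-- The point of the phase space with rescaled variables `v` at `t`. -/
noncomputable def orbitPoint (d : Fin r → ℕ) (ε : ℝ) (v : Path r) (t : unitInterval) : Phase r :=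
  (t * v.2.1 0 t, fun i => coefB d i + (t : ℝ) ^ 2 * v.2.2 i t,
    fun i => if i = 0 then √(radCI d ε v t) else t * v.2.1 i t)

/-- The time change `t = exp (s / d₁)`. -/
noncomputable def expTime (d : Fin r → ℕ) (s : ℝ) : unitInterval := clamp (Real.exp (s / d 0))

section Identities

variable {d : Fin r → ℕ} {ε : ℝ} {v : Path r} {t : unitInterval}

theorem radCI_apply : radCI d ε v t = 1 + (t : ℝ) ^ 2 * v.1 t
    - ε / 2 * ((∑ j, (d j : ℝ)) - 1) * cW (orbitPoint d ε v t) ^ 2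
    - (∑ i, cX (orbitPoint d ε v t) i ^ 2)
    - ∑ i ∈ Finset.univ.erase 0, cY (orbitPoint d ε v t) i ^ 2 := by
  have h : ∑ i ∈ Finset.univ.erase 0, cY (orbitPoint d ε v t) i ^ 2 =
      ∑ i ∈ Finset.univ.erase 0, (t * v.2.1 i t) ^ 2 := Finset.sum_congr rfl fun i hi => by
    simp [orbitPoint, cY, Finset.ne_of_mem_erase hi]
  rw [h]
  simp [radCI, orbitPoint, cX, cW, ContinuousMap.sum_apply, algebraMap_apply]

/-- `radCI` is the value of `Y₁²` forced by `Q = t² q`. -/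
theorem calQ_orbitPoint (h : 0 ≤ radCI d ε v t) :
    calQ d ε (orbitPoint d ε v t) = (t : ℝ) ^ 2 * v.1 t := by
  have h1 := Finset.add_sum_erase Finset.univ (fun i => cY (orbitPoint d ε v t) i ^ 2)
    (Finset.mem_univ 0)
  have h2 : cY (orbitPoint d ε v t) 0 ^ 2 = radCI d ε v t := by
    simp [orbitPoint, cY, Real.sq_sqrt h]
  rw [h2, radCI_apply] at h1
  simp only [calQ, calL, Finset.sum_add_distrib]
  linarith

theorem sqrt_mul_beta (hd0 : 0 < d 0) : √(d 0 : ℝ) * beta d = 1 := by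
  rw [beta]
  have : 0 < √(d 0 : ℝ) := Real.sqrt_pos.2 (by exact_mod_cast hd0)
  field_simp

theorem beta_sq (d : Fin r → ℕ) : beta d ^ 2 = 1 / d 0 := by
  rw [beta, div_pow, one_pow, Real.sq_sqrt (by positivity)]

theorem calH_orbitPoint (hd0 : 0 < d 0) :
    calH d (orbitPoint d ε v t) - 1 = (t : ℝ) ^ 2 * slopeCI d v t := by
  have h1 : ∑ i, √(d i : ℝ) * coefB d i = 1 := by
    simp [coefB, sqrt_mul_beta hd0]
  simp only [calH, orbitPoint, cX, mul_add, Finset.sum_add_distrib, h1, slopeCI,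
    ContinuousMap.sum_apply, ContinuousMap.smul_apply, smul_eq_mul, Finset.mul_sum]
  rw [add_sub_cancel_left]
  exact Finset.sum_congr rfl fun i _ => by ring

/-- The growth rate `1 / d₁` is exactly that of `t`, so only the `t² τ` part survives in the
equations of `W / t` and `Q / t²`. -/
theorem sum_sq_orbitPoint : (∑ i, cX (orbitPoint d ε v t) i ^ 2) =
    1 / d 0 + (t : ℝ) ^ 2 * tauCI d ε v t + ε / 2 * cW (orbitPoint d ε v t) ^ 2 := by
  have h1 : ∀ i, cX (orbitPoint d ε v t) i ^ 2 = coefB d i ^ 2 +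
      2 * (t : ℝ) ^ 2 * (coefB d i * v.2.2 i t) + (t : ℝ) ^ 4 * v.2.2 i t ^ 2 := fun i => by
    simp only [orbitPoint, cX]; ring
  simp_rw [h1, Finset.sum_add_distrib, ← Finset.mul_sum]
  have h2 : ∑ i, coefB d i ^ 2 = 1 / d 0 := by
    simp [coefB, beta_sq]
  have h3 : ∑ i, coefB d i * v.2.2 i t = beta d * v.2.2 0 t := by
    simp [coefB]
  rw [h2, h3]
  simp [tauCI, orbitPoint, cW, ContinuousMap.sum_apply]
  ring

end Identities

section TimeChange

variable {d : Fin r → ℕ} {s : ℝ}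

theorem exp_div_mem (hd0 : 0 < d 0) (hs : s < 0) : Real.exp (s / d 0) ∈ Ioo (0 : ℝ) 1 :=
  ⟨Real.exp_pos _, Real.exp_lt_one_iff.2 (div_neg_of_neg_of_pos hs (by exact_mod_cast hd0))⟩

theorem coe_expTime (hd0 : 0 < d 0) (hs : s < 0) : (expTime d s : ℝ) = Real.exp (s / d 0) := by
  rw [expTime, clamp_of_mem (Ioo_subset_Icc_self (exp_div_mem hd0 hs))]

theorem expTime_pos (hd0 : 0 < d 0) (hs : s < 0) : 0 < (expTime d s : ℝ) := by
  rw [coe_expTime hd0 hs]; exact Real.exp_pos _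

theorem hasDerivAt_exp_div (d : Fin r → ℕ) (s : ℝ) :
    HasDerivAt (fun s : ℝ => Real.exp (s / d 0)) (Real.exp (s / d 0) / d 0) s :=
  ((hasDerivAt_id s).div_const (d 0 : ℝ)).exp.congr_deriv (by simp; ring)

theorem hasDerivAt_expTime (hd0 : 0 < d 0) (hs : s < 0) :
    HasDerivAt (fun s => (expTime d s : ℝ)) (expTime d s / d 0) s := by
  rw [coe_expTime hd0 hs]
  refine (hasDerivAt_exp_div d s).congr_of_eventuallyEq ?_
  filter_upwards [Iio_mem_nhds hs] with x hx using coe_expTime hd0 hx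

theorem hasDerivAt_avg_expTime (hd0 : 0 < d 0) (hs : s < 0) (k : ℕ) (f : CI) :
    HasDerivAt (fun s => avg k f (expTime d s))
      ((f (expTime d s) - (k + 1) * avg k f (expTime d s)) / d 0) s := by
  have h := (hasDerivAt_avg k f (exp_div_mem hd0 hs)).comp s (hasDerivAt_exp_div d s)
  refine h.congr_deriv ?_
  have : Real.exp (s / d 0) ≠ 0 := (Real.exp_pos _).ne'
  rw [expTime]
  field_simp

/-- Under the time change `t d/dt = d₁ d/ds`. The growth of the factor `t²` cancels the damping `k +
1 = 2` of `avg 1`. -/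
theorem hasDerivAt_opLow (hd0 : 0 < d 0) (hs : s < 0) (f : CI) :
    HasDerivAt (fun s => opLow d f (expTime d s)) ((expTime d s : ℝ) ^ 2 * f (expTime d s)) s := by
  have h := ((hasDerivAt_expTime hd0 hs).pow 2).mul (hasDerivAt_avg_expTime hd0 hs 1 f)
    |>.const_mul (d 0 : ℝ)
  have hd : (d 0 : ℝ) ≠ 0 := by exact_mod_cast hd0.ne'
  refine (h.congr_deriv ?_)
  simp only [Pi.pow_apply]
  push_cast
  field_simp
  ring

/-- The damping `1 + 1 / d₁` is the decay rate `1 - 1 / d₁` of `X - X(c)` plus the rate `2 / d₁` of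
`t²`. It equals `(k + 1) / d₁` for `k = d₁`. -/
theorem hasDerivAt_opHigh (hd0 : 0 < d 0) (hs : s < 0) (f : CI) :
    HasDerivAt (fun s => opHigh d f (expTime d s))
      (f (expTime d s) - (1 + 1 / d 0) * opHigh d f (expTime d s)) s := by
  have h := (hasDerivAt_avg_expTime hd0 hs (d 0) f).const_mul (d 0 : ℝ)
  have hd : (d 0 : ℝ) ≠ 0 := by exact_mod_cast hd0.ne'
  refine (h.congr_deriv ?_)
  simp only [opHigh, _root_.smul_apply, ContinuousMap.smul_apply, smul_eq_mul]
  field_simp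

theorem tendsto_expTime (hd0 : 0 < d 0) : Tendsto (expTime d) atBot (𝓝 0) := by
  have h1 : Tendsto (fun s : ℝ => Real.exp (s / d 0)) atBot (𝓝 0) :=
    Real.tendsto_exp_atBot.comp (tendsto_id.atBot_div_const (by exact_mod_cast hd0))
  have h2 := continuous_clamp.tendsto 0 |>.comp h1
  rwa [show clamp 0 = 0 from clamp_val 0] at h2

theorem opLow_zero (f : CI) : opLow d f 0 = 0 := by
  simp [opLow]

theorem opHigh_zero (f : CI) : opHigh d f 0 = d 0 * (f 0 / (d 0 + 1)) := by
  simp [opHigh, avg_zero]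

end TimeChange

section Orbit

variable {d : Fin r → ℕ} {ε : ℝ} {v : Path r} {P : ℝ × (Fin r → ℝ)} {s : ℝ}

theorem fst_eq (hv : v = dataPath d P + nonlin d ε v) :
    v.1 = algebraMap ℝ CI P.1 + opLow d (srcQ d ε v) := congrArg Prod.fst hv

theorem snd_fst_eq (hv : v = dataPath d P + nonlin d ε v) (i : Fin r) :
    v.2.1 i = algebraMap ℝ CI (P.2 i) + opLow d (srcU d ε i v) :=
  congrFun (congrArg (fun z : Path r => z.2.1) hv) i

/-- By linearity of `opHigh`, the part of `q` placed in the data and the part in `nonlin` recombine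
into `q`. -/
theorem snd_snd_eq (hv : v = dataPath d P + nonlin d ε v) (i : Fin r) :
    v.2.2 i = opHigh d (srcX d ε i v + coefB d i • v.1) := by
  have h1 : v.2.2 i = opHigh d (algebraMap ℝ CI (coefB d i * P.1)) +
      opHigh d (srcX d ε i v + coefB d i • opLow d (srcQ d ε v)) :=
    congrFun (congrArg (fun z : Path r => z.2.2) hv) i
  rw [h1, ← map_add, fst_eq hv]
  congr 1
  ext t
  simp [algebraMap_apply]
  ring

theorem hasDerivAt_fst (hd0 : 0 < d 0) (hv : v = dataPath d P + nonlin d ε v) (hs : s < 0) :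
    HasDerivAt (fun s => v.1 (expTime d s))
      ((expTime d s : ℝ) ^ 2 * srcQ d ε v (expTime d s)) s := by
  have h := (hasDerivAt_opLow hd0 hs (srcQ d ε v)).const_add P.1
  refine h.congr_of_eventuallyEq (Eventually.of_forall fun s => ?_)
  simp only
  conv_lhs => rw [fst_eq hv]
  simp [algebraMap_apply]

theorem hasDerivAt_snd_fst (hd0 : 0 < d 0) (hv : v = dataPath d P + nonlin d ε v) (hs : s < 0)
    (i : Fin r) : HasDerivAt (fun s => v.2.1 i (expTime d s))
      ((expTime d s : ℝ) ^ 2 * srcU d ε i v (expTime d s)) s := by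
  have h := (hasDerivAt_opLow hd0 hs (srcU d ε i v)).const_add (P.2 i)
  refine h.congr_of_eventuallyEq (Eventually.of_forall fun s => ?_)
  simp only
  conv_lhs => rw [snd_fst_eq hv]
  simp [algebraMap_apply]

theorem hasDerivAt_snd_snd (hd0 : 0 < d 0) (hv : v = dataPath d P + nonlin d ε v) (hs : s < 0)
    (i : Fin r) : HasDerivAt (fun s => v.2.2 i (expTime d s))
      (srcX d ε i v (expTime d s) + coefB d i * v.1 (expTime d s)
        - (1 + 1 / d 0) * v.2.2 i (expTime d s)) s := by
  have h := hasDerivAt_opHigh hd0 hs (srcX d ε i v + coefB d i • v.1)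
  rw [← snd_snd_eq hv i] at h
  exact h

theorem hasDerivAt_orbit_W (hd0 : 0 < d 0) (hv : v = dataPath d P + nonlin d ε v) (hs : s < 0) :
    HasDerivAt (fun s => cW (orbitPoint d ε v (expTime d s)))
      (cW (field d ε (orbitPoint d ε v (expTime d s)))) s := by
  have h := (hasDerivAt_expTime hd0 hs).mul (hasDerivAt_snd_fst hd0 hv hs 0)
  refine h.congr_deriv ?_
  have h1 : ∀ z : Phase r, cW (field d ε z) =
    cW z * ((∑ j, cX z j ^ 2) - ε / 2 * cW z ^ 2) := fun _ => rfl
  rw [h1, sum_sq_orbitPoint]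
  simp [srcU, coefY, orbitPoint, cW]
  ring

theorem hasDerivAt_orbit_Y (hd0 : 0 < d 0) (hv : v = dataPath d P + nonlin d ε v) (hs : s < 0)
    {i : Fin r} (hi : i ≠ 0) :
    HasDerivAt (fun s => cY (orbitPoint d ε v (expTime d s)) i)
      (cY (field d ε (orbitPoint d ε v (expTime d s))) i) s := by
  have h := (hasDerivAt_expTime hd0 hs).mul (hasDerivAt_snd_fst hd0 hv hs i)
  have h1 : ∀ z : Phase r, cY (field d ε z) i =
    cY z i * ((∑ j, cX z j ^ 2) - cX z i / √(d i) - ε / 2 * cW z ^ 2) := fun _ => rfl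
  rw [h1, sum_sq_orbitPoint]
  simp only [orbitPoint, cY, if_neg hi]
  refine h.congr_deriv ?_
  simp [srcU, coefY, coefB, cX, cW, hi]
  ring

/-- For the first factor, `Y₁²` is eliminated through `Q`: then `X₁ (∑ X_j² - 1) + β Y₁²` becomes
`(X₁ - β)(∑ X_j² - 1)` plus terms in `Q`, `W²` and the other `Y_j²`, which is the origin of `coefB`
and `coefW`. -/
theorem hasDerivAt_orbit_X (hd0 : 0 < d 0) (hv : v = dataPath d P + nonlin d ε v) (hs : s < 0)
    (hR : ∀ t, 0 < radCI d ε v t) (i : Fin r) :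
    HasDerivAt (fun s => cX (orbitPoint d ε v (expTime d s)) i)
      (cX (field d ε (orbitPoint d ε v (expTime d s))) i) s := by
  have h := (((hasDerivAt_expTime hd0 hs).pow 2).mul
    (hasDerivAt_snd_snd hd0 hv hs i)).const_add (coefB d i)
  refine h.congr_deriv ?_
  set t := expTime d s
  rw [show ((fun s => (expTime d s : ℝ)) ^ 2) s = (t : ℝ) ^ 2 from rfl]
  have h1 : ∀ z : Phase r, cX (field d ε z) i = cX z i * ((∑ j, cX z j ^ 2) - 1) +
    cY z i ^ 2 / √(d i) + ε / 2 * (√(d i) - cX z i) * cW z ^ 2 := fun _ => rfl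
  have hR' : cY (orbitPoint d ε v t) 0 ^ 2 = radCI d ε v t := by
    simp [orbitPoint, cY, Real.sq_sqrt (hR t).le]
  have hP : ∑ i ∈ Finset.univ.erase 0, cY (orbitPoint d ε v t) i ^ 2 =
      (t : ℝ) ^ 2 * ∑ i ∈ Finset.univ.erase 0, v.2.1 i t ^ 2 := by
    rw [Finset.mul_sum]
    refine Finset.sum_congr rfl fun i hi => ?_
    simp [orbitPoint, cY, Finset.ne_of_mem_erase hi, mul_pow]
  have hW : cW (orbitPoint d ε v t) = t * v.2.1 0 t := rfl
  rw [h1]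
  by_cases hi : i = 0
  · subst hi
    have hX : cX (orbitPoint d ε v t) 0 = beta d + (t : ℝ) ^ 2 * v.2.2 0 t := by
      simp [orbitPoint, cX, coefB]
    rw [hR', radCI_apply, hP, sum_sq_orbitPoint, hW, hX, div_eq_mul_one_div _ √(d 0 : ℝ)]
    simp only [srcX, coefW, coefY, coefB, if_true, ContinuousMap.sub_apply, ContinuousMap.add_apply,
      ContinuousMap.mul_apply, ContinuousMap.smul_apply, ContinuousMap.pow_apply, idCI_apply,
      smul_eq_mul, ContinuousMap.sum_apply]
    rw [show 1 / √(d 0 : ℝ) = beta d from rfl]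
    push_cast
    ring
  · have hX : cX (orbitPoint d ε v t) i = (t : ℝ) ^ 2 * v.2.2 i t := by
      simp [orbitPoint, cX, coefB, hi]
    have hY : cY (orbitPoint d ε v t) i = t * v.2.1 i t := by
      simp [orbitPoint, cY, hi]
    rw [hY, hX, sum_sq_orbitPoint, hW, div_eq_mul_one_div _ √(d i : ℝ)]
    simp only [srcX, coefW, coefY, coefB, if_neg hi, ContinuousMap.sub_apply,
      ContinuousMap.add_apply, ContinuousMap.mul_apply, ContinuousMap.smul_apply,
      ContinuousMap.pow_apply, idCI_apply, smul_eq_mul, ContinuousMap.sum_apply]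
    push_cast
    ring

/-- `Q = t² q` obeys its evolution equation and all other coordinates obey the system. Subtracting
in `calQ_field` leaves `(Y₁²)' = 2 Y₁ F`, with `F` the `Y₁` component of the field, and `Y₁ > 0`
permits division. -/
theorem hasDerivAt_orbit_Y_zero (hd0 : 0 < d 0) (hv : v = dataPath d P + nonlin d ε v)
    (hs : s < 0) (hR : ∀ t, 0 < radCI d ε v t) :
    HasDerivAt (fun s => cY (orbitPoint d ε v (expTime d s)) 0)
      (cY (field d ε (orbitPoint d ε v (expTime d s))) 0) s := by
  set z : ℝ → Phase r := fun s => orbitPoint d ε v (expTime d s) with hz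
  have hY0 : ∀ s, cY (z s) 0 = √(radCI d ε v (expTime d s)) := fun s => by
    simp [hz, orbitPoint, cY]
  have hQ : HasDerivAt (fun s => (expTime d s : ℝ) ^ 2 * v.1 (expTime d s))
      (2 * ((∑ j, cX (z s) j ^ 2) - ε / 2 * cW (z s) ^ 2) * calQ d ε (z s)
        + ε * cW (z s) ^ 2 * (calH d (z s) - 1)) s := by
    refine (((hasDerivAt_expTime hd0 hs).pow 2).mul (hasDerivAt_fst hd0 hv hs)).congr_deriv ?_
    rw [calQ_orbitPoint (hR _).le, calH_orbitPoint hd0, sum_sq_orbitPoint]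
    simp [srcQ, hz, orbitPoint, cW]
    ring
  have hrad : HasDerivAt (fun s => radCI d ε v (expTime d s))
      (2 * cY (z s) 0 * cY (field d ε (z s)) 0) s := by
    have h := (((hQ.const_add 1).sub (((hasDerivAt_orbit_W hd0 hv hs).pow 2).const_mul
      (ε / 2 * ((∑ j, (d j : ℝ)) - 1)))).sub (HasDerivAt.fun_sum (u := Finset.univ) fun i _ =>
        (hasDerivAt_orbit_X hd0 hv hs hR i).pow 2)).sub
      (HasDerivAt.fun_sum (u := Finset.univ.erase 0) fun i hi =>
        (hasDerivAt_orbit_Y hd0 hv hs (Finset.ne_of_mem_erase hi)).pow 2)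
    refine (h.congr_of_eventuallyEq (Eventually.of_forall fun s => radCI_apply)).congr_deriv ?_
    rw [← calQ_field, Finset.sum_add_distrib,
      ← Finset.add_sum_erase Finset.univ (fun i => 2 * cY (z s) i * cY (field d ε (z s)) i)
        (Finset.mem_univ 0)]
    simp only [show 2 - 1 = 1 from rfl, pow_one, Nat.cast_ofNat, hz]
    ring
  have h := hrad.sqrt (hR _).ne'
  refine (h.congr_of_eventuallyEq (Eventually.of_forall hY0)).congr_deriv ?_
  have hpos : 0 < √(radCI d ε v (expTime d s)) := Real.sqrt_pos.2 (hR _)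
  rw [hY0]
  simp only [hz]
  field_simp

theorem hasDerivAt_orbit (hd0 : 0 < d 0) (hv : v = dataPath d P + nonlin d ε v) (hs : s < 0)
    (hR : ∀ t, 0 < radCI d ε v t) :
    HasDerivAt (fun s => orbitPoint d ε v (expTime d s))
      (field d ε (orbitPoint d ε v (expTime d s))) s := by
  refine (hasDerivAt_orbit_W hd0 hv hs).prodMk ((hasDerivAt_pi.2 fun i =>
    hasDerivAt_orbit_X hd0 hv hs hR i).prodMk (hasDerivAt_pi.2 fun i => ?_))
  by_cases hi : i = 0
  · subst hi; exact hasDerivAt_orbit_Y_zero hd0 hv hs hR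
  · exact hasDerivAt_orbit_Y hd0 hv hs hi

end Orbit

end

/-! ### Behaviour at `c`, entry into the region, and global trajectories. -/

section

variable {r : ℕ} [NeZero r] {d : Fin r → ℕ} {ε : ℝ}

/-- The coordinates `W` and `Y_i`, `i > 1`, indexed together. -/
def mainCoord (i : Fin r) (z : Phase r) : ℝ := if i = 0 then cW z else cY z i

theorem mainCoord_orbitPoint (i : Fin r) (v : Path r) (t : unitInterval) :
    mainCoord i (orbitPoint d ε v t) = t * v.2.1 i t := by
  by_cases hi : i = 0
  · subst hi; simp [mainCoord, orbitPoint, cW]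
  · simp [mainCoord, orbitPoint, cY, hi]

theorem continuous_orbitPoint (v : Path r) : Continuous (orbitPoint d ε v) := by
  unfold orbitPoint
  refine Continuous.prodMk (by fun_prop) (Continuous.prodMk (by fun_prop) ?_)
  refine continuous_pi fun i => ?_
  split_ifs
  · exact (radCI d ε v).continuous.sqrt
  · fun_prop

theorem orbitPoint_zero (v : Path r) : orbitPoint d ε v 0 = critPoint d := by
  have hr : radCI d ε v 0 = 1 - beta d ^ 2 := by
    simp [radCI, ContinuousMap.sum_apply, algebraMap_apply, coefB]
  refine Prod.ext (by simp [orbitPoint, critPoint]) (Prod.ext ?_ ?_)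
  · funext i
    by_cases hi : i = 0
    · subst hi; simp [orbitPoint, critPoint, coefB]
    · simp [orbitPoint, critPoint, coefB, hi]
  · funext i
    by_cases hi : i = 0
    · subst hi; simp [orbitPoint, critPoint, betaHat, hr]
    · simp [orbitPoint, critPoint, hi]

theorem tendsto_orbit (hd0 : 0 < d 0) (v : Path r) :
    Tendsto (fun s => orbitPoint d ε v (expTime d s)) atBot (𝓝 (critPoint d)) := by
  have := ((continuous_orbitPoint (d := d) (ε := ε) v).tendsto 0).comp (tendsto_expTime hd0)
  rwa [orbitPoint_zero] at this

theorem sum_sqrt_coefB (hd0 : 0 < d 0) : ∑ i, √(d i : ℝ) * coefB d i = 1 := by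
  simp [coefB, sqrt_mul_beta hd0]

theorem sum_sqrt_coefW (hd0 : 0 < d 0) : ∑ i, √(d i : ℝ) * coefW d ε i = 0 := by
  have h1 : ∀ i, √(d i : ℝ) * coefW d ε i = ε / 2 * (d i : ℝ) -
      if i = 0 then ε / 2 * ∑ j, (d j : ℝ) else 0 := fun i => by
    have hsq : √(d i : ℝ) * √(d i) = d i := Real.mul_self_sqrt (by positivity)
    by_cases hi : i = 0
    · subst hi
      simp only [coefW, if_true]
      linear_combination (ε / 2) * hsq - (ε / 2) * (∑ j, (d j : ℝ)) * sqrt_mul_beta hd0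
    · simp only [coefW, if_neg hi]
      linear_combination (ε / 2) * hsq
  simp_rw [h1]
  rw [Finset.sum_sub_distrib, ← Finset.mul_sum]
  simp

theorem sum_sqrt_coefY (hd : ∀ i, 0 < d i) (f : Fin r → ℝ) :
    ∑ i, √(d i : ℝ) * (coefY d i * f i) = ∑ i ∈ Finset.univ.erase 0, f i := by
  rw [← Finset.add_sum_erase _ _ (Finset.mem_univ 0)]
  have h0 : √(d 0 : ℝ) * (coefY d 0 * f 0) = 0 := by simp [coefY]
  rw [h0, zero_add]
  refine Finset.sum_congr rfl fun i hi => ?_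
  have : 0 < √(d i : ℝ) := Real.sqrt_pos.2 (by exact_mod_cast hd i)
  simp only [coefY, if_neg (Finset.ne_of_mem_erase hi)]
  field_simp

section Solution

variable {v : Path r} {P : ℝ × (Fin r → ℝ)}

theorem fst_zero (hv : v = dataPath d P + nonlin d ε v) : v.1 0 = P.1 := by
  rw [fst_eq hv]; simp [opLow_zero, algebraMap_apply]

theorem snd_fst_zero (hv : v = dataPath d P + nonlin d ε v) (i : Fin r) : v.2.1 i 0 = P.2 i := by
  rw [snd_fst_eq hv]; simp [opLow_zero, algebraMap_apply]

/-- In the weighted sum of the `x_i(0)` the coefficients of `W²` add up to zero and the `u_j²` terms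
cancel, so only `q(0)` remains. Hence `H < 1` near `c` follows from `q(0) < 0`. -/
theorem slopeCI_at_zero (hd : ∀ i, 0 < d i) (hv : v = dataPath d P + nonlin d ε v) :
    slopeCI d v 0 = d 0 / (d 0 + 1) * P.1 := by
  have h1 : ∀ i, √(d i : ℝ) * v.2.2 i 0 = (d 0 / (d 0 + 1) : ℝ) *
      ((√(d i) * coefW d ε i) * v.2.1 0 0 ^ 2 + √(d i) * (coefY d i * v.2.1 i 0 ^ 2)
        - √(d i) * coefB d i * (∑ j ∈ Finset.univ.erase 0, v.2.1 j 0 ^ 2)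
        + √(d i) * coefB d i * P.1) := fun i => by
    rw [snd_snd_eq hv, opHigh_zero]
    simp only [srcX, ContinuousMap.sub_apply, ContinuousMap.add_apply, ContinuousMap.mul_apply,
      ContinuousMap.smul_apply, ContinuousMap.pow_apply, idCI_apply, smul_eq_mul,
      ContinuousMap.sum_apply, fst_zero hv]
    simp only [Set.Icc.coe_zero]
    ring
  have h2 : slopeCI d v 0 = ∑ i, √(d i : ℝ) * v.2.2 i 0 := by
    simp [slopeCI, ContinuousMap.sum_apply]
  rw [h2]
  simp_rw [h1]
  rw [← Finset.mul_sum]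
  simp only [Finset.sum_add_distrib, Finset.sum_sub_distrib, ← Finset.sum_mul,
    sum_sqrt_coefB (hd 0), sum_sqrt_coefW (hd 0), sum_sqrt_coefY hd (fun i => v.2.1 i 0 ^ 2)]
  ring

/-- The signs of `q`, `u_i` and `k` at `t = 0` settle all very negative times; forward invariance
does the rest. -/
theorem inRegion_orbit (hd : ∀ i, 0 < d i) (hε : 0 < ε) (hv : v = dataPath d P + nonlin d ε v)
    (hR : ∀ t, 0 < radCI d ε v t) (hP1 : P.1 < 0) (hP2 : ∀ i, 0 < P.2 i) {s : ℝ} (hs : s < 0) :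
    InRegion d ε (orbitPoint d ε v (expTime d s)) := by
  have hev : ∀ᶠ s in atBot, InRegion d ε (orbitPoint d ε v (expTime d s)) := by
    have hq : ∀ᶠ t in 𝓝 (0 : unitInterval), v.1 t < 0 :=
      (v.1.continuous.tendsto 0).eventually_lt_const (by rwa [fst_zero hv])
    have hu : ∀ᶠ t in 𝓝 (0 : unitInterval), ∀ i, 0 < v.2.1 i t := eventually_all.2 fun i =>
      ((v.2.1 i).continuous.tendsto 0).eventually_const_lt (by rw [snd_fst_zero hv]; exact hP2 i)
    have hk : ∀ᶠ t in 𝓝 (0 : unitInterval), slopeCI d v t < 0 :=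
      ((slopeCI d v).continuous.tendsto 0).eventually_lt_const (by
        rw [slopeCI_at_zero hd hv]
        have : (0 : ℝ) < d 0 := by exact_mod_cast hd 0
        exact mul_neg_of_pos_of_neg (by positivity) hP1)
    filter_upwards [(tendsto_expTime (hd 0)).eventually (hq.and (hu.and hk)), eventually_lt_atBot 0]
      with s ⟨h1, h2, h3⟩ hs
    have ht := expTime_pos (hd 0) hs
    refine ⟨⟨mul_pos ht (h2 0), fun i => ?_⟩, sub_neg.1 ?_, ?_⟩
    · by_cases hi : i = 0
      · subst hi; simpa [orbitPoint, cY] using hR _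
      · simpa [orbitPoint, cY, hi] using mul_pos ht (h2 i)
    · rw [calH_orbitPoint (hd 0)]
      exact mul_neg_of_pos_of_neg (by positivity) h3
    · rw [calQ_orbitPoint (hR _).le]
      exact mul_neg_of_pos_of_neg (by positivity) h1
  obtain ⟨s₀, h0, hs0⟩ := (hev.and (eventually_le_atBot s)).exists
  exact InRegion.forward_invariant hd hε hs0
    (γ := fun s => orbitPoint d ε v (expTime d s))
    (fun x hx => hasDerivAt_orbit (hd 0) hv (hx.2.trans_lt hs) hR) h0

/-- The global trajectory with given initial data. -/
theorem exists_global_orbit (hd : ∀ i, 0 < d i) (hd1 : 1 < d 0) (hε : 0 < ε)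
    (hv : v = dataPath d P + nonlin d ε v)
    (hR : ∀ t, 0 < radCI d ε v t) (hP1 : P.1 < 0) (hP2 : ∀ i, 0 < P.2 i) :
    ∃ γ : ℝ → Phase r, (∀ s < 0, γ s = orbitPoint d ε v (expTime d s)) ∧
      (∀ s, HasDerivAt γ (field d ε (γ s)) s) ∧ ∀ s, InRegion d ε (γ s) :=
  exists_extension hd hd1 hε (fun _ hs => hasDerivAt_orbit (hd 0) hv hs hR)
    (fun _ hs => inRegion_orbit hd hε hv hR hP1 hP2 hs)

end Solution

theorem contDiffAt_orbitPoint {v : Path r} {t : unitInterval} (h : 0 < radCI d ε v t)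
    {n : WithTop ℕ∞} : ContDiffAt ℝ n (fun v => orbitPoint d ε v t) v := by
  have hev : ContDiff ℝ n (fun f : CI => f t) :=
    (ContinuousMap.evalCLM ℝ t : CI →L[ℝ] ℝ).contDiff
  have hrad : ContDiffAt ℝ n (fun v => radCI d ε v t) v :=
    (hev.comp (contDiff_radCI d ε)).contDiffAt
  unfold orbitPoint
  refine ContDiffAt.prodMk ?_ (ContDiffAt.prodMk ?_ ?_)
  · exact contDiffAt_const.mul (hev.comp (by fun_prop)).contDiffAt
  · exact contDiffAt_pi.2 fun i => contDiffAt_const.add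
      (contDiffAt_const.mul (hev.comp (by fun_prop)).contDiffAt)
  · refine contDiffAt_pi.2 fun i => ?_
    split_ifs
    · exact hrad.sqrt h.ne'
    · exact contDiffAt_const.mul (hev.comp (by fun_prop)).contDiffAt

end

/-! ### Propagating smoothness and kernels along a family of trajectories. -/

section

/-- Connectedness of `ℝ`: the hypothesis makes `S` and its complement open. It is met when a
property passes between nearby times, in both directions, by the local flow. -/
theorem eq_univ_of_locally_all_or_none {S : Set ℝ} (hS : S.Nonempty)
    (h : ∀ s, ∃ N ∈ 𝓝 s, ∀ a ∈ N, ∀ b ∈ N, a ∈ S → b ∈ S) : S = univ := by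
  refine IsClopen.eq_univ ⟨isOpen_compl_iff.1 ?_, ?_⟩ hS
  · refine isOpen_iff_mem_nhds.2 fun s hs => ?_
    obtain ⟨N, hN, hN'⟩ := h s
    filter_upwards [hN] with a ha haS
    exact hs (hN' a ha s (mem_of_mem_nhds hN) haS)
  · refine isOpen_iff_mem_nhds.2 fun s hs => ?_
    obtain ⟨N, hN, hN'⟩ := h s
    filter_upwards [hN] with a ha using hN' s (mem_of_mem_nhds hN) a ha hs

variable {r : ℕ} {d : Fin r → ℕ} {ε : ℝ}

section Family

variable {U : Set (Fin r → ℝ)} {Φ : (Fin r → ℝ) → ℝ → Phase r}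

/-- Along a trajectory, the time-`(b - a)` map of the flow is locally given by analytic maps. -/
theorem exists_flow_nhds (hΦ : ∀ p ∈ U, ∀ s, HasDerivAt (Φ p) (field d ε (Φ p s)) s)
    {p₀ : Fin r → ℝ} (hp₀ : p₀ ∈ U) (s : ℝ) :
    ∃ φ : ℝ × Phase r → Phase r, ∃ N ∈ 𝓝 s, ∀ a ∈ N, ∀ b ∈ N,
      ContDiffAt ℝ ω φ (b - a, Φ p₀ a) ∧
      ∀ᶠ q in 𝓝 (b - a, Φ p₀ a), ∀ p ∈ U, ∀ σ : ℝ, Φ p σ = q.2 → Φ p (σ + q.1) = φ q := by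
  obtain ⟨φ, hφ, hrep⟩ := exists_smooth_flow d ε (Φ p₀ s)
  have hcont : Continuous (Φ p₀) :=
    continuous_iff_continuousAt.2 fun s => (hΦ p₀ hp₀ s).continuousAt
  -- For `a`, `b` near `s` the point `(b - a, Φ p₀ a)` is near `(0, Φ p₀ s)`, so one flow map serves
  -- all such pairs.
  have hm : Tendsto (fun q : ℝ × ℝ => (q.2 - q.1, Φ p₀ q.1)) (𝓝 (s, s)) (𝓝 (0, Φ p₀ s)) := by
    have : Continuous (fun q : ℝ × ℝ => (q.2 - q.1, Φ p₀ q.1)) := by fun_prop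
    simpa using this.tendsto (s, s)
  have hev := hm.eventually ((hφ.eventually (by simp)).and hrep.eventually_nhds)
  rw [nhds_prod_eq] at hev
  obtain ⟨N, hN, hN'⟩ := mem_prod_same_iff.1 hev
  refine ⟨φ, _, hN, fun a ha b hb => ⟨(hN' (mk_mem_prod ha hb)).1, ?_⟩⟩
  filter_upwards [(hN' (mk_mem_prod ha hb)).2] with q hq p hp σ hσ
  exact hq (Φ p) σ hσ (hΦ p hp)

/-- Near time `a` one has `Φ p σ = φ (σ - a, Φ p a)`, so smoothness in `p` at one time gives joint
smoothness at nearby times, hence at all. -/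
theorem contDiffAt_family (hU : IsOpen U)
    (hΦ : ∀ p ∈ U, ∀ s, HasDerivAt (Φ p) (field d ε (Φ p s)) s) {p₀ : Fin r → ℝ} (hp₀ : p₀ ∈ U)
    {n : WithTop ℕ∞} {s₀ : ℝ} (h0 : ContDiffAt ℝ n (fun p => Φ p s₀) p₀) (s : ℝ) :
    ContDiffAt ℝ n (fun q : (Fin r → ℝ) × ℝ => Φ q.1 q.2) (p₀, s) := by
  have key : ∀ s, ∃ N ∈ 𝓝 s, ∀ a ∈ N, ∀ b ∈ N, ContDiffAt ℝ n (fun p => Φ p a) p₀ →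
      ContDiffAt ℝ n (fun q : (Fin r → ℝ) × ℝ => Φ q.1 q.2) (p₀, b) := by
    intro s
    obtain ⟨φ, N, hN, h⟩ := exists_flow_nhds hΦ hp₀ s
    refine ⟨N, hN, fun a ha b hb hab => ?_⟩
    obtain ⟨h1, h2⟩ := h a ha b hb
    have h3 : ContDiffAt ℝ n (fun q : (Fin r → ℝ) × ℝ => (q.2 - a, Φ q.1 a)) (p₀, b) :=
      (contDiffAt_snd.sub contDiffAt_const).prodMk (ContDiffAt.fst'' (x := (p₀, b)) hab)
    have h4 : ContDiffAt ℝ n (fun q : (Fin r → ℝ) × ℝ => φ (q.2 - a, Φ q.1 a)) (p₀, b) :=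
      ContDiffAt.comp (p₀, b) (h1.of_le le_top) h3
    refine h4.congr_of_eventuallyEq ?_
    have hUev : ∀ᶠ q : (Fin r → ℝ) × ℝ in 𝓝 (p₀, b), q.1 ∈ U :=
      continuous_fst.continuousAt.eventually (hU.mem_nhds hp₀)
    filter_upwards [h3.continuousAt.eventually h2, hUev] with q hq hqU
    have := hq q.1 hqU a rfl
    simpa using this
  have hall : {s | ContDiffAt ℝ n (fun p => Φ p s) p₀} = univ := by
    refine eq_univ_of_locally_all_or_none ⟨s₀, h0⟩ fun s => ?_
    obtain ⟨N, hN, h⟩ := key s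
    refine ⟨N, hN, fun a ha b hb hab => ?_⟩
    exact ContDiffAt.comp p₀ (h a ha b hb hab) (contDiffAt_id.prodMk contDiffAt_const)
  obtain ⟨N, hN, h⟩ := key s
  exact h s (mem_of_mem_nhds hN) s (mem_of_mem_nhds hN) (eq_univ_iff_forall.1 hall s)

/-- The kernel of the derivative of a family of trajectories does not depend on time. -/
theorem fderiv_family_eq_zero (hU : IsOpen U)
    (hΦ : ∀ p ∈ U, ∀ s, HasDerivAt (Φ p) (field d ε (Φ p s)) s) {p₀ : Fin r → ℝ} (hp₀ : p₀ ∈ U)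
    (hdiff : ∀ s, DifferentiableAt ℝ (fun q : (Fin r → ℝ) × ℝ => Φ q.1 q.2) (p₀, s))
    {w : (Fin r → ℝ) × ℝ} {s₀ : ℝ}
    (h0 : fderiv ℝ (fun q : (Fin r → ℝ) × ℝ => Φ q.1 q.2) (p₀, s₀) w = 0) (s : ℝ) :
    fderiv ℝ (fun q : (Fin r → ℝ) × ℝ => Φ q.1 q.2) (p₀, s) w = 0 := by
  set f : (Fin r → ℝ) × ℝ → Phase r := fun q => Φ q.1 q.2 with hf
  have hall : {s | fderiv ℝ f (p₀, s) w = 0} = univ := by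
    refine eq_univ_of_locally_all_or_none ⟨s₀, h0⟩ fun s => ?_
    obtain ⟨φ, N, hN, h⟩ := exists_flow_nhds hΦ hp₀ s
    refine ⟨N, hN, fun a ha b hb hab => ?_⟩
    obtain ⟨h1, h2⟩ := h a ha b hb
    have hin : HasFDerivAt (fun q => (b - a, f q))
        ((0 : (Fin r → ℝ) × ℝ →L[ℝ] ℝ).prod (fderiv ℝ f (p₀, a))) (p₀, a) :=
      (hasFDerivAt_const (b - a) (p₀, a)).prodMk (hdiff a).hasFDerivAt
    have hL := HasFDerivAt.comp (p₀, a)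
      (f := fun q => (b - a, f q)) (h1.differentiableAt (by simp)).hasFDerivAt hin
    -- The shift by `b - a` has identity derivative, and the family after this shift is a flow map
    -- applied to the family. The derivative at `b` thus factors through the one at `a`.
    have hs : HasFDerivAt (fun q : (Fin r → ℝ) × ℝ => (q.1, q.2 + (b - a)))
        (ContinuousLinearMap.id ℝ ((Fin r → ℝ) × ℝ)) (p₀, a) :=
      (hasFDerivAt_fst.prodMk (hasFDerivAt_snd.add_const (b - a))).congr_fderiv rfl
    have hb' : HasFDerivAt f (fderiv ℝ f (p₀, b)) (p₀, a + (b - a)) := by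
      rw [add_sub_cancel]; exact (hdiff b).hasFDerivAt
    have hRt := HasFDerivAt.comp (p₀, a)
      (f := fun q : (Fin r → ℝ) × ℝ => (q.1, q.2 + (b - a))) hb' hs
    have hUev : ∀ᶠ q : (Fin r → ℝ) × ℝ in 𝓝 (p₀, a), q.1 ∈ U :=
      continuous_fst.continuousAt.eventually (hU.mem_nhds hp₀)
    have heq : (f ∘ fun q : (Fin r → ℝ) × ℝ => (q.1, q.2 + (b - a))) =ᶠ[𝓝 (p₀, a)]
        (φ ∘ fun q => (b - a, f q)) := by
      filter_upwards [hin.continuousAt.eventually h2, hUev] with q hq hqU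
      exact hq q.1 hqU q.2 rfl
    have := hRt.unique (hL.congr_of_eventuallyEq heq)
    have h3 := DFunLike.congr_fun this w
    simp only [ContinuousLinearMap.comp_apply, ContinuousLinearMap.prod_apply] at h3
    change fderiv ℝ f (p₀, b) w = 0
    rw [ContinuousLinearMap.id_apply] at h3
    rw [h3, hab]
    exact map_zero _
  exact eq_univ_iff_forall.1 hall s

/-- A kernel vector of the derivative of the family annihilates every observable. -/
theorem add_mul_eq_zero_of_fderiv_eq_zero {m : Phase r → ℝ} {p₀ δp : Fin r → ℝ} {δs s : ℝ}
    (hdiff : DifferentiableAt ℝ (fun q : (Fin r → ℝ) × ℝ => Φ q.1 q.2) (p₀, s))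
    (h0 : fderiv ℝ (fun q : (Fin r → ℝ) × ℝ => Φ q.1 q.2) (p₀, s) (δp, δs) = 0)
    (hm : DifferentiableAt ℝ m (Φ p₀ s)) {a b : ℝ}
    (ha : HasDerivAt (fun θ : ℝ => m (Φ (p₀ + θ • δp) s)) a 0)
    (hb : HasDerivAt (fun s => m (Φ p₀ s)) b s) : a + δs * b = 0 := by
  set L := (fderiv ℝ m (Φ p₀ s)).comp
    (fderiv ℝ (fun q : (Fin r → ℝ) × ℝ => Φ q.1 q.2) (p₀, s)) with hL
  have hM : HasFDerivAt (fun q : (Fin r → ℝ) × ℝ => m (Φ q.1 q.2)) L (p₀, s) :=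
    HasFDerivAt.comp (p₀, s) (by exact hm.hasFDerivAt) hdiff.hasFDerivAt
  have h1 : HasDerivAt (fun θ : ℝ => m (Φ (p₀ + θ • δp) s)) (L (δp, 0)) 0 := by
    have hc : HasDerivAt (fun θ : ℝ => (p₀ + θ • δp, s)) (δp, (0 : ℝ)) 0 := by
      have := ((hasDerivAt_id (0 : ℝ)).smul_const δp).const_add p₀
      rw [one_smul] at this
      exact this.prodMk (hasDerivAt_const _ _)
    exact HasFDerivAt.comp_hasDerivAt (0 : ℝ) (f := fun θ : ℝ => (p₀ + θ • δp, s))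
      (l := fun q : (Fin r → ℝ) × ℝ => m (Φ q.1 q.2)) (by simpa using hM) hc
  have h2 : HasDerivAt (fun s => m (Φ p₀ s)) (L (0, 1)) s := by
    have hc : HasDerivAt (fun s : ℝ => (p₀, s)) ((0 : Fin r → ℝ), (1 : ℝ)) s :=
      (hasDerivAt_const _ _).prodMk (hasDerivAt_id s)
    exact HasFDerivAt.comp_hasDerivAt s (f := fun s : ℝ => (p₀, s))
      (l := fun q : (Fin r → ℝ) × ℝ => m (Φ q.1 q.2)) hM hc
  rw [ha.unique h1, hb.unique h2]
  have h3 : L (δp, δs) = L (δp, 0) + δs * L (0, 1) := by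
    rw [← smul_eq_mul, ← map_smul, ← map_add]
    simp
  rw [← h3, hL, ContinuousLinearMap.comp_apply, h0, map_zero]

end Family

end

/-! ### The family with fixed `q(0)`: smoothness, injectivity and immersion. -/

section

variable {r : ℕ} [NeZero r] {d : Fin r → ℕ} {ε : ℝ}

/-- `Φ` consists of the global trajectories whose rescaled variables solve the integral equation
with initial data `(q₀, p)`, `p ∈ U`. -/
structure IsOrbitFamily (d : Fin r → ℕ) (ε q₀ : ℝ) (U : Set (Fin r → ℝ))
    (v : ℝ × (Fin r → ℝ) → Path r) (Φ : (Fin r → ℝ) → ℝ → Phase r) : Prop where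
  isOpen : IsOpen U
  neg : q₀ < 0
  analytic : ∀ p ∈ U, ContDiffAt ℝ ω v (q₀, p)
  eq : ∀ p ∈ U, v (q₀, p) = dataPath d (q₀, p) + nonlin d ε (v (q₀, p))
  rad_pos : ∀ p ∈ U, ∀ t, 0 < radCI d ε (v (q₀, p)) t
  eq_orbit : ∀ p ∈ U, ∀ s < 0, Φ p s = orbitPoint d ε (v (q₀, p)) (expTime d s)
  solves : ∀ p ∈ U, ∀ s, HasDerivAt (Φ p) (field d ε (Φ p s)) s
  inRegion : ∀ p ∈ U, ∀ s, InRegion d ε (Φ p s)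

/-- Fixing `q(0)` at a negative value removes the redundancy due to time shifts. The value `-ρ / 2`
keeps `(q(0), p)` in the ball of solvable data, the norm being a maximum. -/
theorem exists_orbitFamily (hd : ∀ i, 0 < d i) (hd1 : 1 < d 0) (hε : 0 < ε) :
    ∃ q₀ U v Φ, U.Nonempty ∧ IsOrbitFamily d ε q₀ U v Φ := by
  obtain ⟨v, hv, hev⟩ := exists_local_solutions d ε hd1
  obtain ⟨ρ, hρ, hball⟩ := Metric.eventually_nhds_iff_ball.1 ((hv.eventually (by simp)).and hev)
  set U : Set (Fin r → ℝ) := univ.pi (fun _ => Ioi 0) ∩ Metric.ball 0 ρ with hU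
  have hmem : ∀ p ∈ U, ((-(ρ / 2), p) : ℝ × (Fin r → ℝ)) ∈ Metric.ball 0 ρ := fun p hp => by
    rw [mem_ball_zero_iff, Prod.norm_def, max_lt_iff]
    refine ⟨?_, mem_ball_zero_iff.1 hp.2⟩
    rw [norm_neg, Real.norm_of_nonneg (by positivity)]
    linarith
  have hex : ∀ p, ∃ γ : ℝ → Phase r, p ∈ U →
      (∀ s < 0, γ s = orbitPoint d ε (v (-(ρ / 2), p)) (expTime d s)) ∧
      (∀ s, HasDerivAt γ (field d ε (γ s)) s) ∧ ∀ s, InRegion d ε (γ s) := fun p => by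
    by_cases hp : p ∈ U
    · obtain ⟨-, h1, h2⟩ := hball _ (hmem p hp)
      obtain ⟨γ, hγ⟩ := exists_global_orbit hd hd1 hε h1 h2 (by simp only; linarith)
        (fun i => hp.1 i (mem_univ i))
      exact ⟨γ, fun _ => hγ⟩
    · exact ⟨0, fun h => absurd h hp⟩
  choose Φ hΦ using hex
  refine ⟨-(ρ / 2), U, v, Φ, ⟨fun _ => ρ / 2, fun i _ => ?_, ?_⟩, ?_⟩
  · exact half_pos hρ
  · rw [mem_ball_zero_iff]
    refine lt_of_le_of_lt ((pi_norm_le_iff_of_nonneg (by positivity)).2 fun i => ?_)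
      (half_lt_self hρ)
    rw [Real.norm_of_nonneg (by positivity)]
  · exact
    { isOpen := (isOpen_set_pi finite_univ fun _ _ => isOpen_Ioi).inter Metric.isOpen_ball
      neg := by linarith
      analytic := fun p hp => (hball _ (hmem p hp)).1
      eq := fun p hp => (hball _ (hmem p hp)).2.1
      rad_pos := fun p hp => (hball _ (hmem p hp)).2.2
      eq_orbit := fun p hp => (hΦ p hp).1
      solves := fun p hp => (hΦ p hp).2.1
      inRegion := fun p hp => (hΦ p hp).2.2 }

theorem eq_zero_of_expTime {f : CI} (hd0 : 0 < d 0) (h : ∀ s < 0, f (expTime d s) = 0) :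
    f 0 = 0 := by
  refine tendsto_nhds_unique ((f.continuous.tendsto 0).comp (tendsto_expTime hd0))
    (tendsto_const_nhds.congr' ?_)
  filter_upwards [eventually_lt_atBot 0] with s hs using (h s hs).symm

theorem differentiable_mainCoord (i : Fin r) : Differentiable ℝ (mainCoord (r := r) i) := by
  unfold mainCoord cW cY
  split_ifs <;> fun_prop

namespace IsOrbitFamily

variable {q₀ : ℝ} {U : Set (Fin r → ℝ)} {v : ℝ × (Fin r → ℝ) → Path r}
  {Φ : (Fin r → ℝ) → ℝ → Phase r}

theorem contDiffAt (h : IsOrbitFamily d ε q₀ U v Φ) {p : Fin r → ℝ} (hp : p ∈ U) (s : ℝ)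
    {n : WithTop ℕ∞} : ContDiffAt ℝ n (fun q : (Fin r → ℝ) × ℝ => Φ q.1 q.2) (p, s) := by
  -- Any negative starting time would do: there the family is given explicitly by `orbitPoint`.
  refine contDiffAt_family h.isOpen h.solves hp (s₀ := -1) ?_ s
  have h1 : ContDiffAt ℝ n (fun p => v (q₀, p)) p :=
    ContDiffAt.comp p ((h.analytic p hp).of_le le_top) (contDiffAt_const.prodMk contDiffAt_id)
  have h2 : ContDiffAt ℝ n (fun p => orbitPoint d ε (v (q₀, p)) (expTime d (-1))) p :=
    ContDiffAt.comp (g := fun v => orbitPoint d ε v (expTime d (-1))) p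
      (contDiffAt_orbitPoint (h.rad_pos p hp _)) h1
  refine h2.congr_of_eventuallyEq ?_
  filter_upwards [h.isOpen.mem_nhds hp] with p hp using h.eq_orbit p hp _ (by norm_num)

theorem tendsto (h : IsOrbitFamily d ε q₀ U v Φ) (hd0 : 0 < d 0) {p : Fin r → ℝ} (hp : p ∈ U) :
    Tendsto (Φ p) atBot (𝓝 (critPoint d)) := by
  refine (tendsto_orbit (ε := ε) hd0 (v (q₀, p))).congr' ?_
  filter_upwards [eventually_lt_atBot 0] with s hs using (h.eq_orbit p hp s hs).symm

theorem mainCoord_eq (h : IsOrbitFamily d ε q₀ U v Φ) {p : Fin r → ℝ} (hp : p ∈ U) {s : ℝ}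
    (hs : s < 0) (i : Fin r) :
    mainCoord i (Φ p s) = expTime d s * (v (q₀, p)).2.1 i (expTime d s) := by
  rw [h.eq_orbit p hp s hs, mainCoord_orbitPoint]

theorem calQ_eq (h : IsOrbitFamily d ε q₀ U v Φ) {p : Fin r → ℝ} (hp : p ∈ U) {s : ℝ}
    (hs : s < 0) :
    calQ d ε (Φ p s) = (expTime d s : ℝ) ^ 2 * (v (q₀, p)).1 (expTime d s) := by
  rw [h.eq_orbit p hp s hs, calQ_orbitPoint (h.rad_pos p hp _).le]

/-- A common point forces equal orbits up to a time shift. Comparing leading terms as `s → -∞` gives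
`p = κ p'` and `q₀ = κ² q₀`; as `q₀ ≠ 0` and `κ > 0`, `κ = 1`. -/
theorem injOn (h : IsOrbitFamily d ε q₀ U v Φ) (hd0 : 0 < d 0) :
    InjOn (fun q : (Fin r → ℝ) × ℝ => Φ q.1 q.2) (U ×ˢ univ) := by
  rintro ⟨p, s⟩ ⟨hp, -⟩ ⟨p', s'⟩ ⟨hp', -⟩ heq
  simp only at hp hp' heq
  have hshift : ∀ σ, Φ p (s + σ) = Φ p' (s' + σ) := fun σ =>
    ode_unique (contDiff_field d ε) (S := univ) ordConnected_univ
      (f := fun σ => Φ p (s + σ)) (g := fun σ => Φ p' (s' + σ))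
      (fun t _ => (h.solves p hp (s + t)).comp_const_add s t)
      (fun t _ => (h.solves p' hp' (s' + t)).comp_const_add s' t)
      (s := 0) (mem_univ _) (by simpa using heq) (mem_univ σ)
  set κ : ℝ := Real.exp ((s' - s) / d 0) with hκ
  have hκ0 : 0 < κ := Real.exp_pos _
  have hev : ∀ᶠ σ : ℝ in atBot, s + σ < 0 ∧ s' + σ < 0 := by
    filter_upwards [eventually_lt_atBot (-s), eventually_lt_atBot (-s')] with σ h1 h2
    exact ⟨by linarith, by linarith⟩
  have hT : ∀ σ, s + σ < 0 → s' + σ < 0 →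
      (expTime d (s' + σ) : ℝ) = κ * expTime d (s + σ) := fun σ h1 h2 => by
    rw [coe_expTime hd0 h1, coe_expTime hd0 h2, hκ, ← Real.exp_add]
    congr 1
    ring
  have hlim : ∀ (s : ℝ) (f : CI), Tendsto (fun σ => f (expTime d (s + σ))) atBot (𝓝 (f 0)) :=
    fun s f => (f.continuous.tendsto 0).comp ((tendsto_expTime hd0).comp
      (tendsto_atBot_add_const_left _ s tendsto_id))
  have hp_eq : ∀ i, p i = κ * p' i := fun i => by
    have h1 := hlim s ((v (q₀, p)).2.1 i)
    have h2 := (hlim s' ((v (q₀, p')).2.1 i)).const_mul κ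
    rw [snd_fst_zero (h.eq p hp)] at h1
    rw [snd_fst_zero (h.eq p' hp')] at h2
    refine tendsto_nhds_unique h1 (h2.congr' ?_)
    filter_upwards [hev] with σ ⟨hs1, hs2⟩
    have h3 := congrArg (mainCoord i) (hshift σ)
    rw [h.mainCoord_eq hp hs1, h.mainCoord_eq hp' hs2, hT σ hs1 hs2] at h3
    have h4 := expTime_pos hd0 hs1
    exact mul_left_cancel₀ h4.ne' (by linear_combination -h3)
  have hq_eq : q₀ = κ ^ 2 * q₀ := by
    have h1 := hlim s (v (q₀, p)).1
    have h2 := (hlim s' (v (q₀, p')).1).const_mul (κ ^ 2)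
    rw [fst_zero (h.eq p hp)] at h1
    rw [fst_zero (h.eq p' hp')] at h2
    refine tendsto_nhds_unique h1 (h2.congr' ?_)
    filter_upwards [hev] with σ ⟨hs1, hs2⟩
    have h3 := congrArg (calQ d ε) (hshift σ)
    rw [h.calQ_eq hp hs1, h.calQ_eq hp' hs2, hT σ hs1 hs2] at h3
    have h4 := expTime_pos hd0 hs1
    exact mul_left_cancel₀ (pow_ne_zero 2 h4.ne') (by linear_combination -h3)
  have hκ1 : κ = 1 := by
    have h1 : κ ^ 2 = 1 := mul_right_cancel₀ h.neg.ne (by linear_combination -hq_eq)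
    nlinarith
  have hss : s' - s = 0 := by
    rw [hκ, Real.exp_eq_one_iff, div_eq_zero_iff] at hκ1
    exact hκ1.resolve_right (by exact_mod_cast hd0.ne')
  refine Prod.ext (funext fun i => ?_) (by simp only; linarith)
  simp [hp_eq i, hκ1]

/-- A kernel vector `(δp, δs)` is one at every time, so it can be tested as `s → -∞`. The leading
term of `Q` gives `δs * (2 / d₁) * q₀ = 0`, and then those of `W` and `Y_i` give `δp = 0`. -/
theorem immersion (h : IsOrbitFamily d ε q₀ U v Φ) (hd0 : 0 < d 0) {p : Fin r → ℝ} (hp : p ∈ U)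
    (s₀ : ℝ) :
    Function.Injective (fderiv ℝ (fun q : (Fin r → ℝ) × ℝ => Φ q.1 q.2) (p, s₀)) := by
  rw [injective_iff_map_eq_zero]
  rintro ⟨δp, δs⟩ h0
  have hdiff : ∀ s, DifferentiableAt ℝ (fun q : (Fin r → ℝ) × ℝ => Φ q.1 q.2) (p, s) := fun s =>
    (h.contDiffAt hp s (n := 1)).differentiableAt one_ne_zero
  have hker := fderiv_family_eq_zero h.isOpen h.solves hp hdiff h0
  set w : Path r := fderiv ℝ v (q₀, p) (0, δp)
  have hline : HasDerivAt (fun θ : ℝ => p + θ • δp) δp 0 := by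
    have := ((hasDerivAt_id (0 : ℝ)).smul_const δp).const_add p
    rwa [one_smul] at this
  have hvθ : HasDerivAt (fun θ : ℝ => v (q₀, p + θ • δp)) w 0 :=
    HasFDerivAt.comp_hasDerivAt (0 : ℝ) (f := fun θ : ℝ => (q₀, p + θ • δp)) (l := v)
      (by simpa using ((h.analytic p hp).differentiableAt (by simp)).hasFDerivAt)
      ((hasDerivAt_const _ _).prodMk hline)
  have hev : ∀ᶠ θ : ℝ in 𝓝 0, p + θ • δp ∈ U :=
    hline.continuousAt.eventually (h.isOpen.mem_nhds (by simpa using hp))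
  have hu : ∀ (i : Fin r) (t : unitInterval),
      HasDerivAt (fun θ : ℝ => (v (q₀, p + θ • δp)).2.1 i t) (w.2.1 i t) 0 := fun i t =>
    ((ContinuousMap.evalCLM ℝ t : CI →L[ℝ] ℝ).comp ((ContinuousLinearMap.proj i).comp
      ((ContinuousLinearMap.fst ℝ (Fin r → CI) (Fin r → CI)).comp
        (ContinuousLinearMap.snd ℝ CI _)))).hasFDerivAt.comp_hasDerivAt 0 hvθ
  have hq : ∀ t : unitInterval,
      HasDerivAt (fun θ : ℝ => (v (q₀, p + θ • δp)).1 t) (w.1 t) 0 := fun t =>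
    ((ContinuousMap.evalCLM ℝ t : CI →L[ℝ] ℝ).comp
      (ContinuousLinearMap.fst ℝ CI ((Fin r → CI) × (Fin r → CI)))).hasFDerivAt.comp_hasDerivAt 0 hvθ
  have hw1 : w.1 0 = 0 := by
    refine (hq 0).unique ((hasDerivAt_const (0 : ℝ) q₀).congr_of_eventuallyEq ?_)
    filter_upwards [hev] with θ hθ using fst_zero (h.eq _ hθ)
  have hw2 : ∀ i, w.2.1 i 0 = δp i := fun i => by
    refine (hu i 0).unique ((hasDerivAt_pi.1 hline i).congr_of_eventuallyEq ?_)
    filter_upwards [hev] with θ hθ using snd_fst_zero (h.eq _ hθ) i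
  -- Divided by `t²`, the kernel identity says that a continuous function of `t` vanishes along
  -- `expTime`; its value at `t = 0` is the claim.
  have hQ : w.1 0 + δs * (2 / d 0 * q₀) = 0 := by
    have := eq_zero_of_expTime (d := d) (f := w.1 + δs • ((2 / d 0 : ℝ) • (v (q₀, p)).1 +
      idCI ^ 2 * srcQ d ε (v (q₀, p)))) hd0 (fun s hs => by
        have ha := ((hq (expTime d s)).const_mul ((expTime d s : ℝ) ^ 2)).congr_of_eventuallyEq
          (f₁ := fun θ : ℝ => calQ d ε (Φ (p + θ • δp) s))
          (hev.mono fun θ hθ => h.calQ_eq hθ hs)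
        have hb := (((hasDerivAt_expTime hd0 hs).pow 2).mul
          (hasDerivAt_fst hd0 (h.eq p hp) hs)).congr_of_eventuallyEq
          (f₁ := fun s => calQ d ε (Φ p s))
          (by filter_upwards [Iio_mem_nhds hs] with x hx using h.calQ_eq hp hx)
        have := add_mul_eq_zero_of_fderiv_eq_zero (hdiff s) (hker s)
          (differentiable_calQ (d := d) (ε := ε) _) ha hb
        have ht := expTime_pos hd0 hs
        refine mul_left_cancel₀ (pow_ne_zero 2 ht.ne') ?_
        simp only [Pi.pow_apply, show 2 - 1 = 1 from rfl, pow_one, Nat.cast_ofNat] at this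
        simp only [ContinuousMap.add_apply, ContinuousMap.smul_apply, ContinuousMap.mul_apply,
          ContinuousMap.pow_apply, idCI_apply, smul_eq_mul]
        linear_combination this)
    simpa [fst_zero (h.eq p hp)] using this
  have hU : ∀ i, w.2.1 i 0 + δs * (1 / d 0 * p i) = 0 := fun i => by
    have := eq_zero_of_expTime (d := d) (f := w.2.1 i + δs • ((1 / d 0 : ℝ) • (v (q₀, p)).2.1 i +
      idCI ^ 2 * srcU d ε i (v (q₀, p)))) hd0 (fun s hs => by
        have ha := ((hu i (expTime d s)).const_mul (expTime d s : ℝ)).congr_of_eventuallyEq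
          (f₁ := fun θ : ℝ => mainCoord i (Φ (p + θ • δp) s))
          (hev.mono fun θ hθ => h.mainCoord_eq hθ hs i)
        have hb := ((hasDerivAt_expTime hd0 hs).mul
          (hasDerivAt_snd_fst hd0 (h.eq p hp) hs i)).congr_of_eventuallyEq
          (f₁ := fun s => mainCoord i (Φ p s))
          (by filter_upwards [Iio_mem_nhds hs] with x hx using h.mainCoord_eq hp hx i)
        have := add_mul_eq_zero_of_fderiv_eq_zero (hdiff s) (hker s)
          (differentiable_mainCoord i _) ha hb
        have ht := expTime_pos hd0 hs
        refine mul_left_cancel₀ ht.ne' ?_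
        simp only [ContinuousMap.add_apply, ContinuousMap.smul_apply, ContinuousMap.mul_apply,
          ContinuousMap.pow_apply, idCI_apply, smul_eq_mul]
        linear_combination this)
    simpa [snd_fst_zero (h.eq p hp)] using this
  have hd0' : (d 0 : ℝ) ≠ 0 := by exact_mod_cast hd0.ne'
  have hδs : δs = 0 := by
    rw [hw1, zero_add] at hQ
    exact (mul_eq_zero.1 hQ).resolve_right (mul_ne_zero (div_ne_zero two_ne_zero hd0') h.neg.ne)
  refine Prod.ext (funext fun i => ?_) hδs
  have := hU i
  rw [hw2, hδs, zero_mul, add_zero] at this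
  exact this

theorem isParameterFamily (h : IsOrbitFamily d ε q₀ U v Φ) (hU : U.Nonempty) (hd0 : 0 < d 0) :
    IsParameterFamily U Φ where
  isOpen := h.isOpen
  nonempty := hU
  smooth := fun q hq => (h.contDiffAt hq.1 q.2).contDiffWithinAt
  injOn := h.injOn hd0
  immersion := fun _ hp s => h.immersion hd0 hp s

end IsOrbitFamily

theorem mem_unstableManifold {γ : ℝ → Phase r} (hγ : ∀ s, HasDerivAt γ (field d ε (γ s)) s)
    (hlim : Tendsto γ atBot (𝓝 (critPoint d))) (s : ℝ) : γ s ∈ unstableManifold d ε :=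
  ⟨fun σ => γ (s + σ), by simp, fun σ _ => ((hγ (s + σ)).comp_const_add s σ).hasDerivWithinAt,
    hlim.comp (tendsto_atBot_add_const_left _ s tendsto_id)⟩

theorem isBounded_range_of_inRegion (hd1 : 1 < d 0) (hε : 0 < ε) {γ : ℝ → Phase r}
    (h : ∀ s, InRegion d ε (γ s)) : Bornology.IsBounded (range γ) :=
  Metric.isBounded_closedBall.subset (range_subset_iff.2 fun s => (h s).mem_closedBall hd1 hε)

end

end ExpandingSoliton

theorem mainTheorem3 (r : ℕ) [NeZero r] (d : Fin r → ℕ) (hd : ∀ i, 0 < d i) (hd1 : 1 < d 0)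
    (ε : ℝ) (hε : 0 < ε) :
    -- the family of trajectories, which exist for all times, and the bounds along it
    (∃ (U : Set (Fin r → ℝ)) (Φ : (Fin r → ℝ) → ℝ → ExpandingSoliton.Phase r),
      ExpandingSoliton.IsParameterFamily U Φ ∧
      ∀ p ∈ U,
        ExpandingSoliton.IsEmanatingTrajectory d ε Set.univ (Φ p) ∧
        Bornology.IsBounded (Set.range (Φ p)) ∧
        ∀ s : ℝ,
          Φ p s ∈ ExpandingSoliton.unstableManifold d ε ∧
          ExpandingSoliton.calH d (Φ p s) < 1 ∧
          ExpandingSoliton.calQ d ε (Φ p s) < 0 ∧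
          ExpandingSoliton.calL (Φ p s) < 0 ∧
          ExpandingSoliton.cW (Φ p s) < √(2 / ε)) ∧
    -- the consequences for every trajectory with `H < 1` and `Q < 0`
    (∀ (b : ℝ) (γ : ℝ → ExpandingSoliton.Phase r),
      ExpandingSoliton.IsEmanatingTrajectory d ε (Set.Iio b) γ →
      (∀ s < b, ExpandingSoliton.calH d (γ s) < 1 ∧ ExpandingSoliton.calQ d ε (γ s) < 0) →
      (∀ s < b, ExpandingSoliton.calL (γ s) < 0 ∧ ExpandingSoliton.cW (γ s) < √(2 / ε)) ∧
      ∃ γ' : ℝ → ExpandingSoliton.Phase r,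
        Set.EqOn γ' γ (Set.Iio b) ∧
        ExpandingSoliton.IsEmanatingTrajectory d ε Set.univ γ' ∧
        Bornology.IsBounded (Set.range γ') ∧
        ∀ s : ℝ,
          ExpandingSoliton.calH d (γ' s) < 1 ∧
          ExpandingSoliton.calQ d ε (γ' s) < 0 ∧
          ExpandingSoliton.calL (γ' s) < 0 ∧
          ExpandingSoliton.cW (γ' s) < √(2 / ε)) := by
  constructor
  · obtain ⟨q₀, U, v, Φ, hU, h⟩ := ExpandingSoliton.exists_orbitFamily hd hd1 hε
    refine ⟨U, Φ, h.isParameterFamily hU (hd 0), fun p hp => ⟨?_, ?_, fun s => ?_⟩⟩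
    · exact ⟨fun s _ => h.solves p hp s, h.tendsto (hd 0) hp, fun s _ => (h.inRegion p hp s).1.1,
        fun s _ => (h.inRegion p hp s).1.2⟩
    · exact ExpandingSoliton.isBounded_range_of_inRegion hd1 hε (h.inRegion p hp)
    · exact ⟨ExpandingSoliton.mem_unstableManifold (h.solves p hp) (h.tendsto (hd 0) hp) s,
        (h.inRegion p hp s).2.1, (h.inRegion p hp s).2.2, (h.inRegion p hp s).bounds hd1 hε⟩
  · intro b γ hγ hHQ
    have hreg : ∀ s ∈ Set.Iio b, ExpandingSoliton.InRegion d ε (γ s) := fun s hs =>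
      ⟨⟨hγ.W_pos s hs, hγ.Y_pos s hs⟩, hHQ s hs⟩
    refine ⟨fun s hs => (hreg s hs).bounds hd1 hε, ?_⟩
    obtain ⟨γ', heq, hsol, hreg'⟩ := ExpandingSoliton.exists_extension hd hd1 hε hγ.solves hreg
    refine ⟨γ', heq, ⟨fun s _ => hsol s, ?_, fun s _ => (hreg' s).1.1, fun s _ => (hreg' s).1.2⟩,
      ExpandingSoliton.isBounded_range_of_inRegion hd1 hε hreg',
      fun s => ⟨(hreg' s).2.1, (hreg' s).2.2, (hreg' s).bounds hd1 hε⟩⟩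
    exact hγ.tendsto_critPoint.congr'
      ((heq.eventuallyEq_of_mem (Filter.Iio_mem_atBot b)).symm)
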